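/- Let $G_1$ and $G_2$ be two nontrivial countable discrete groups, at least one of which has more than two elements. Let $G=G_1*G_2$, $K=G_1\times G_2$, let $p\colon G\to K$ be the canonical homomorphism and $H=\ker p$. For $a\in G_1\setminus\{e\}$ and $b\in G_2\setminus\{e\}$ put $[a,b]=aba^{-1}b^{-1}\in H$, and let $X\subset H$ be the set of all these commutators. Let $A=C^*(H)$ be the full group C$^*$-algebra of $H$, with canonical map $i_H\colon H\to A$. Let $\widehat A^{\circ}$ be the set of unitary equivalence classes $[\pi]$ of faithful irreducible representations $\pi$ of $A$. The natural action of $K$ on $\widehat A^{\circ}$ is $k\cdot[\pi]=[\pi\circ\alpha_{k^{-1}}]$, where $\alpha_k(i_H(h))=i_H(n(k)hn(k)^{-1})$ for a normalized section $n\colon K\to G$ for $p$ (it does not depend on the choice of $n$). A point $x\in\widehat A^{\circ}$ is free if $k\cdot x\neq x$ for all $k\in K$, $k\neq e$. Then $H$ is free on the commutators $[a,b]$ (which are pairwise distinct), and there are a faithful irreducible representation $\pi$ of $A$ and a function $\lambda\colon X\to\mathbb T$ such that $[\pi\circ\gamma_\lambda]$ is a free point for the natural action of $K$ on $\widehat A^{\circ}$,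 where $\gamma_\lambda$ is the $*$-automorphism of $A$ determined by $\gamma_\lambda(i_H(x))=\lambda(x)\,i_H(x)$ for $x\in X$. Moreover, $\pi$ can be taken to be a Choi representation: there is $x_0\in X$ such that, for each $x\in X$ with $x\neq x_0$, the unitary operator $\pi(i_H(x))$ is diagonal relative to some orthonormal basis (depending on $x$) of the Hilbert space of $\pi$. -/

import Mathlib

universe u v w

noncomputable section

/-! ### The full group C*-algebra of a discrete group -/

/-- A unitary representation of the discrete group `H` on a complex Hilbert space. -/
structure UnitaryRep (H : Type u) [Group H] : Type (u + 1) where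
  /-- the underlying Hilbert space -/
  space : Type u
  [normed : NormedAddCommGroup space]
  [inner : InnerProductSpace ℂ space]
  [complete : CompleteSpace space]
  /-- the unitary operators -/
  toHom : H →* unitary (space →L[ℂ] space)

attribute [instance] UnitaryRep.normed UnitaryRep.inner UnitaryRep.complete

/-- The group algebra `ℂ[H]`, to be equipped with its maximal C*-seminorm. -/
def PreGroupCStar (H : Type u) [Group H] : Type u := MonoidAlgebra ℂ H

namespace PreGroupCStar

variable {H : Type u} [Group H]

instance : Ring (PreGroupCStar H) := inferInstanceAs (Ring (MonoidAlgebra ℂ H))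

instance : Algebra ℂ (PreGroupCStar H) := inferInstanceAs (Algebra ℂ (MonoidAlgebra ℂ H))

/-- The element `c • h` of the group algebra. -/
def single (h : H) (c : ℂ) : PreGroupCStar H := MonoidAlgebra.single h c

theorem induction {P : PreGroupCStar H → Prop} (f : PreGroupCStar H) (zero : P 0)
    (add : ∀ f g, P f → P g → P (f + g)) (single : ∀ h c, P (single h c)) : P f :=
  MonoidAlgebra.induction_linear f zero (fun f g => add f g) single

theorem single_mul (g h : H) (c d : ℂ) : single g c * single h d = single (g * h) (c * d) :=
  MonoidAlgebra.single_mul_single g h c d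

theorem smul_single (c : ℂ) (h : H) (d : ℂ) : c • single h d = single h (c * d) :=
  MonoidAlgebra.smul_single' c h d

theorem one_def : (1 : PreGroupCStar H) = single 1 1 := rfl

/-- The additive map underlying the involution `(∑ c_h h)^* = ∑ conj(c_h) h⁻¹`. -/
def starHom : PreGroupCStar H →+ PreGroupCStar H :=
  (MonoidAlgebra.coeffAddEquiv.symm.toAddMonoidHom.comp
    (Finsupp.liftAddHom fun h : H =>
      (Finsupp.singleAddHom h⁻¹).comp (starAddEquiv (R := ℂ)).toAddMonoidHom)).comp
    (MonoidAlgebra.coeffAddEquiv (R := ℂ) (M := H)).toAddMonoidHom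

theorem starHom_single (h : H) (c : ℂ) : starHom (single h c) = single h⁻¹ (star c) := by
  change MonoidAlgebra.ofCoeff (Finsupp.liftAddHom _ (Finsupp.single h c)) = _
  rw [Finsupp.liftAddHom_apply_single]
  rfl

instance : StarRing (PreGroupCStar H) where
  star f := starHom f
  star_involutive f := by
    induction f using induction with
    | zero => simp
    | add f g hf hg => simp only [map_add, hf, hg]
    | single h c => simp [starHom_single]
  star_add f g := map_add _ _ _
  star_mul f g := by
    induction f using induction with
    | zero => simp
    | add f₁ f₂ h₁ h₂ => simp only [add_mul, mul_add, map_add, h₁, h₂]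
    | single h c =>
      induction g using induction with
      | zero => simp
      | add f₁ f₂ h₁ h₂ => simp only [add_mul, mul_add, map_add, h₁, h₂]
      | single h' c' => simp [single_mul, starHom_single, mul_comm]

theorem star_single (h : H) (c : ℂ) : star (single h c) = single h⁻¹ (star c) :=
  starHom_single h c

theorem star_smul' (c : ℂ) (f : PreGroupCStar H) : star (c • f) = star c • star f := by
  induction f using induction with
  | zero => simp
  | add f g hf hg => simp only [smul_add, star_add, hf, hg]
  | single h d => simp only [smul_single, star_single, star_mul']

/-- The linear extension of a unitary representation of `H` to the group algebra. -/
def lift (ρ : UnitaryRep H) : PreGroupCStar H →ₐ[ℂ] (ρ.space →L[ℂ] ρ.space) :=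
  MonoidAlgebra.lift ℂ _ H ((unitary (ρ.space →L[ℂ] ρ.space)).subtype.comp ρ.toHom)

theorem lift_single (ρ : UnitaryRep H) (h : H) (c : ℂ) :
    lift ρ (single h c) = c • (ρ.toHom h : ρ.space →L[ℂ] ρ.space) :=
  MonoidAlgebra.lift_single _ _ _

theorem lift_star (ρ : UnitaryRep H) (f : PreGroupCStar H) : lift ρ (star f) = star (lift ρ f) := by
  induction f using induction with
  | zero => simp
  | add f g hf hg => simp only [star_add, map_add, hf, hg]
  | single h c => simp [star_single, lift_single, ← Unitary.star_eq_inv]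

theorem exists_bound (f : PreGroupCStar H) : ∃ C : ℝ, ∀ ρ : UnitaryRep H, ‖lift ρ f‖ ≤ C := by
  induction f using induction with
  | zero => exact ⟨0, fun ρ => by simp⟩
  | add f g hf hg =>
    obtain ⟨C, hC⟩ := hf
    obtain ⟨D, hD⟩ := hg
    refine ⟨C + D, fun ρ => ?_⟩
    rw [map_add]
    exact (norm_add_le _ _).trans (add_le_add (hC ρ) (hD ρ))
  | single h c =>
    refine ⟨‖c‖, fun ρ => ?_⟩
    rw [lift_single, norm_smul]
    refine mul_le_of_le_one_right (norm_nonneg _) ?_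
    refine ContinuousLinearMap.opNorm_le_bound _ zero_le_one fun ξ => ?_
    rw [one_mul]
    exact (Unitary.norm_map (ρ.toHom h) ξ).le

/-- The maximal C*-seminorm on `ℂ[H]`: the supremum of `‖ρ(f)‖` over all unitary
representations `ρ` of `H`. -/
def maxNorm (f : PreGroupCStar H) : ℝ := ⨆ ρ : UnitaryRep H, ‖lift ρ f‖

theorem bddAbove (f : PreGroupCStar H) :
    BddAbove (Set.range fun ρ : UnitaryRep H => ‖lift ρ f‖) := by
  obtain ⟨C, hC⟩ := exists_bound f
  exact ⟨C, by rintro _ ⟨ρ, rfl⟩; exact hC ρ⟩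

theorem le_maxNorm (ρ : UnitaryRep H) (f : PreGroupCStar H) : ‖lift ρ f‖ ≤ maxNorm f :=
  le_ciSup (bddAbove f) ρ

theorem maxNorm_nonneg (f : PreGroupCStar H) : 0 ≤ maxNorm f :=
  Real.iSup_nonneg fun _ => norm_nonneg _

theorem maxNorm_le {f : PreGroupCStar H} {C : ℝ} (h0 : 0 ≤ C)
    (h : ∀ ρ : UnitaryRep H, ‖lift ρ f‖ ≤ C) : maxNorm f ≤ C :=
  Real.iSup_le h h0

/-- The maximal C*-seminorm as a ring seminorm. -/
def ringSeminorm : RingSeminorm (PreGroupCStar H) where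
  toFun := maxNorm
  map_zero' := le_antisymm (maxNorm_le le_rfl fun ρ => by simp) (maxNorm_nonneg _)
  add_le' f g := maxNorm_le (add_nonneg (maxNorm_nonneg _) (maxNorm_nonneg _)) fun ρ => by
    rw [map_add]
    exact (norm_add_le _ _).trans (add_le_add (le_maxNorm ρ f) (le_maxNorm ρ g))
  neg' f := by simp [maxNorm]
  mul_le' f g := maxNorm_le (mul_nonneg (maxNorm_nonneg _) (maxNorm_nonneg _)) fun ρ => by
    rw [map_mul]
    exact (norm_mul_le _ _).trans
      (mul_le_mul (le_maxNorm ρ f) (le_maxNorm ρ g) (norm_nonneg _) (maxNorm_nonneg _))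

instance : SeminormedRing (PreGroupCStar H) := ringSeminorm.toSeminormedRing

theorem norm_def (f : PreGroupCStar H) : ‖f‖ = maxNorm f := rfl

instance : NormedAlgebra ℂ (PreGroupCStar H) where
  norm_smul_le c f := maxNorm_le (mul_nonneg (norm_nonneg _) (maxNorm_nonneg _)) fun ρ => by
    rw [map_smul, norm_smul]
    exact mul_le_mul_of_nonneg_left (le_maxNorm ρ f) (norm_nonneg _)

theorem norm_star' (f : PreGroupCStar H) : ‖star f‖ = ‖f‖ := by
  simp only [norm_def, maxNorm, lift_star, norm_star]

theorem norm_mul_self_le' (f : PreGroupCStar H) : ‖f‖ * ‖f‖ ≤ ‖star f * f‖ := by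
  have h : ‖f‖ ≤ Real.sqrt ‖star f * f‖ := by
    refine maxNorm_le (Real.sqrt_nonneg _) fun ρ => Real.le_sqrt_of_sq_le ?_
    rw [sq, ← CStarRing.norm_star_mul_self, ← lift_star, ← map_mul]
    exact le_maxNorm ρ _
  calc ‖f‖ * ‖f‖ ≤ Real.sqrt ‖star f * f‖ * Real.sqrt ‖star f * f‖ :=
        mul_self_le_mul_self (norm_nonneg _) h
    _ = ‖star f * f‖ := Real.mul_self_sqrt (norm_nonneg _)

theorem isometry_star : Isometry (star : PreGroupCStar H → PreGroupCStar H) :=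
  AddMonoidHomClass.isometry_of_norm (starHom (H := H)) norm_star'

end PreGroupCStar

/-- The full group C*-algebra `C*(H)` of the discrete group `H`: the completion of the group
algebra `ℂ[H]` in its maximal C*-seminorm. -/
def GroupCStar (H : Type u) [Group H] : Type u := UniformSpace.Completion (PreGroupCStar H)

namespace GroupCStar

open UniformSpace

variable {H : Type u} [Group H]

instance : NormedRing (GroupCStar H) :=
  inferInstanceAs (NormedRing (Completion (PreGroupCStar H)))

instance : CompleteSpace (GroupCStar H) :=
  inferInstanceAs (CompleteSpace (Completion (PreGroupCStar H)))

instance : NormedAlgebra ℂ (GroupCStar H) where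
  __ := (inferInstance : Algebra ℂ (Completion (PreGroupCStar H)))
  norm_smul_le :=
    (inferInstance : NormedSpace ℂ (Completion (PreGroupCStar H))).norm_smul_le

/-- The canonical map `ℂ[H] → C*(H)`. -/
def ofPre : PreGroupCStar H →ₐ[ℂ] GroupCStar H where
  __ := (Completion.coeRingHom : PreGroupCStar H →+* Completion (PreGroupCStar H))
  commutes' _ := rfl

theorem norm_ofPre (f : PreGroupCStar H) : ‖ofPre f‖ = ‖f‖ := Completion.norm_coe f

theorem continuous_ofPre : Continuous (ofPre : PreGroupCStar H → GroupCStar H) :=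
  Completion.continuous_coe _

theorem denseRange_ofPre : DenseRange (ofPre : PreGroupCStar H → GroupCStar H) :=
  Completion.denseRange_coe

theorem induction {P : GroupCStar H → Prop} (x : GroupCStar H) (hP : IsClosed {x | P x})
    (h : ∀ f, P (ofPre f)) : P x :=
  Completion.induction_on x hP h

instance : Star (GroupCStar H) where
  star x := Completion.map (star : PreGroupCStar H → PreGroupCStar H) x

theorem star_ofPre (f : PreGroupCStar H) : star (ofPre f) = ofPre (star f) :=
  Completion.map_coe PreGroupCStar.isometry_star.uniformContinuous f

instance : ContinuousStar (GroupCStar H) where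
  continuous_star := Completion.continuous_map

instance : StarRing (GroupCStar H) where
  star_involutive x := by
    induction x using induction with
    | hP => exact isClosed_eq (by fun_prop) (by fun_prop)
    | h f => rw [star_ofPre, star_ofPre, star_star]
  star_add x y := by
    induction x using induction with
    | hP => exact isClosed_eq (by fun_prop) (by fun_prop)
    | h f =>
      induction y using induction with
      | hP => exact isClosed_eq (by fun_prop) (by fun_prop)
      | h g => rw [← map_add, star_ofPre, star_ofPre, star_ofPre, ← map_add, star_add]
  star_mul x y := by
    induction x using induction with
    | hP => exact isClosed_eq (by fun_prop) (by fun_prop)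
    | h f =>
      induction y using induction with
      | hP => exact isClosed_eq (by fun_prop) (by fun_prop)
      | h g => rw [← map_mul, star_ofPre, star_ofPre, star_ofPre, ← map_mul, star_mul]

instance : CStarRing (GroupCStar H) where
  norm_mul_self_le x := by
    induction x using induction with
    | hP => exact isClosed_le (by fun_prop) (by fun_prop)
    | h f =>
      rw [star_ofPre, ← map_mul, norm_ofPre, norm_ofPre]
      exact PreGroupCStar.norm_mul_self_le' f

instance : StarModule ℂ (GroupCStar H) where
  star_smul c x := by
    induction x using induction with
    | hP =>
      exact isClosed_eq (continuous_star.comp (continuous_const_smul c))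
        (continuous_star.const_smul (star c))
    | h f => rw [← map_smul, star_ofPre, star_ofPre, ← map_smul, PreGroupCStar.star_smul']

instance : CStarAlgebra (GroupCStar H) where

/-- The canonical map `i_H : H → C*(H)`. -/
def of (h : H) : GroupCStar H := ofPre (PreGroupCStar.single h 1)

/-- Pulling back unitary representations along a group homomorphism. -/
def _root_.UnitaryRep.comap {H' : Type u} [Group H'] (φ : H →* H') (ρ : UnitaryRep H') :
    UnitaryRep H where
  space := ρ.space
  toHom := ρ.toHom.comp φ

/-- The homomorphism of group algebras induced by a group homomorphism. -/
def preMap {H' : Type u} [Group H'] (φ : H →* H') : PreGroupCStar H →ₐ[ℂ] PreGroupCStar H' :=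
  MonoidAlgebra.mapDomainAlgHom ℂ ℂ φ

theorem preMap_single {H' : Type u} [Group H'] (φ : H →* H') (h : H) (c : ℂ) :
    preMap φ (PreGroupCStar.single h c) = PreGroupCStar.single (φ h) c :=
  MonoidAlgebra.mapDomain_single

theorem preMap_star {H' : Type u} [Group H'] (φ : H →* H') (f : PreGroupCStar H) :
    preMap φ (star f) = star (preMap φ f) := by
  induction f using PreGroupCStar.induction with
  | zero => simp
  | add f g hf hg => simp only [star_add, map_add, hf, hg]
  | single h c => simp [PreGroupCStar.star_single, preMap_single]

theorem lift_preMap {H' : Type u} [Group H'] (φ : H →* H') (ρ : UnitaryRep H')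
    (f : PreGroupCStar H) :
    PreGroupCStar.lift ρ (preMap φ f) = PreGroupCStar.lift (ρ.comap φ) f := by
  induction f using PreGroupCStar.induction with
  | zero => rw [map_zero, map_zero]; exact (map_zero _).symm
  | add f g hf hg => rw [map_add, map_add, hf, hg]; exact (map_add _ _ _).symm
  | single h c =>
    rw [preMap_single, PreGroupCStar.lift_single, PreGroupCStar.lift_single]
    rfl

theorem norm_preMap_le {H' : Type u} [Group H'] (φ : H →* H') (f : PreGroupCStar H) :
    ‖preMap φ f‖ ≤ ‖f‖ :=
  PreGroupCStar.maxNorm_le (norm_nonneg _) fun ρ => by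
    rw [lift_preMap]
    exact PreGroupCStar.le_maxNorm _ f

theorem continuous_preMap {H' : Type u} [Group H'] (φ : H →* H') : Continuous (preMap φ) :=
  AddMonoidHomClass.continuous_of_bound (preMap φ) 1 fun f => by
    simpa using norm_preMap_le φ f

/-- The ring homomorphism `C*(H) → C*(H')` induced by a group homomorphism `H → H'`. -/
def mapRingHom {H' : Type u} [Group H'] (φ : H →* H') : GroupCStar H →+* GroupCStar H' :=
  Completion.mapRingHom (preMap φ : PreGroupCStar H →+* PreGroupCStar H') (continuous_preMap φ)

theorem mapRingHom_ofPre {H' : Type u} [Group H'] (φ : H →* H') (f : PreGroupCStar H) :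
    mapRingHom φ (ofPre f) = ofPre (preMap φ f) :=
  Completion.mapRingHom_coe
    (f := (preMap φ : PreGroupCStar H →+* PreGroupCStar H'))
    (continuous_preMap φ) f

theorem continuous_mapRingHom {H' : Type u} [Group H'] (φ : H →* H') :
    Continuous (mapRingHom φ) :=
  Completion.continuous_map

/-- The *-homomorphism `C*(H) → C*(H')` with `i_H(h) ↦ i_{H'}(φ(h))` induced by a group
homomorphism `φ : H → H'`. -/
def map {H' : Type u} [Group H'] (φ : H →* H') : GroupCStar H →⋆ₐ[ℂ] GroupCStar H' where
  __ := mapRingHom φ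
  commutes' c := by
    change mapRingHom φ (algebraMap ℂ _ c) = _
    rw [← AlgHom.commutes ofPre, mapRingHom_ofPre, AlgHom.commutes, AlgHom.commutes]
  map_star' x := by
    change mapRingHom φ (star x) = star (mapRingHom φ x)
    induction x using induction with
    | hP =>
      have := continuous_mapRingHom φ
      exact isClosed_eq (by fun_prop) (by fun_prop)
    | h f => rw [star_ofPre, mapRingHom_ofPre, mapRingHom_ofPre, star_ofPre, preMap_star]

theorem map_ofPre {H' : Type u} [Group H'] (φ : H →* H') (f : PreGroupCStar H) :
    map φ (ofPre f) = ofPre (preMap φ f) :=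
  mapRingHom_ofPre φ f

theorem map_of {H' : Type u} [Group H'] (φ : H →* H') (h : H) : map φ (of h) = of (φ h) := by
  rw [of, map_ofPre, preMap_single, of]

theorem map_map_of_leftInverse {H' : Type u} [Group H'] (φ : H →* H') (ψ : H' →* H)
    (hψ : Function.LeftInverse ψ φ) (x : GroupCStar H) : map ψ (map φ x) = x := by
  induction x using induction with
  | hP =>
    have h₁ : Continuous (map φ) := continuous_mapRingHom φ
    have h₂ : Continuous (map ψ) := continuous_mapRingHom ψ
    exact isClosed_eq (by fun_prop) (by fun_prop)
  | h f =>
    rw [map_ofPre, map_ofPre]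
    congr 1
    induction f using PreGroupCStar.induction with
    | zero => simp
    | add f g hf hg => rw [map_add, map_add, hf, hg]
    | single h c => rw [preMap_single, preMap_single, hψ h]

/-- The *-automorphism of `C*(H)` with `i_H(h) ↦ i_H(e(h))` induced by an automorphism `e`
of `H`. -/
def congr (e : MulAut H) : GroupCStar H ≃⋆ₐ[ℂ] GroupCStar H where
  toFun := map e.toMonoidHom
  invFun := map e.symm.toMonoidHom
  left_inv := map_map_of_leftInverse _ _ e.symm_apply_apply
  right_inv := map_map_of_leftInverse _ _ e.apply_symm_apply
  map_mul' := map_mul _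
  map_add' := map_add _
  map_star' := map_star _
  map_smul' := map_smul _

theorem congr_of (e : MulAut H) (h : H) : congr e (of h) = of (e h) :=
  map_of _ h

end GroupCStar

/-! ### Faithful irreducible representations and their classes -/

/-- A (unital) faithful irreducible representation of a unital C*-algebra on a complex Hilbert
space. Irreducible: the space is nonzero, and its only closed invariant subspaces are trivial. -/
structure FaithfulIrrep (A : Type u) [CStarAlgebra A] : Type (u + 1) where
  /-- the underlying Hilbert space -/
  space : Type u
  [normed : NormedAddCommGroup space]
  [inner : InnerProductSpace ℂ space]
  [complete : CompleteSpace space]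
  /-- the representation -/
  toHom : A →⋆ₐ[ℂ] (space →L[ℂ] space)
  faithful : Function.Injective toHom
  nontrivial : Nontrivial space
  irreducible : ∀ W : Submodule ℂ space, IsClosed (W : Set space) →
    (∀ a, ∀ ξ ∈ W, toHom a ξ ∈ W) → W = ⊥ ∨ W = ⊤

attribute [instance] FaithfulIrrep.normed FaithfulIrrep.inner FaithfulIrrep.complete

namespace FaithfulIrrep

variable {A : Type u} [CStarAlgebra A]

/-- Unitary equivalence of representations. -/
def Equivalent (π ρ : FaithfulIrrep A) : Prop :=
  ∃ U : π.space ≃ₗᵢ[ℂ] ρ.space, ∀ a ξ, U (π.toHom a ξ) = ρ.toHom a (U ξ)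

instance setoid (A : Type u) [CStarAlgebra A] : Setoid (FaithfulIrrep A) where
  r := Equivalent
  iseqv :=
    { refl := fun π => ⟨LinearIsometryEquiv.refl ℂ _, fun _ _ => rfl⟩
      symm := by
        rintro π ρ ⟨U, hU⟩
        refine ⟨U.symm, fun a ξ => U.injective ?_⟩
        rw [hU, U.apply_symm_apply, U.apply_symm_apply]
      trans := by
        rintro π ρ τ ⟨U, hU⟩ ⟨V, hV⟩
        refine ⟨U.trans V, fun a ξ => ?_⟩
        rw [LinearIsometryEquiv.trans_apply, hU, hV, LinearIsometryEquiv.trans_apply] }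

/-- The representation `π ∘ γ`, for a *-automorphism `γ`. -/
def comp (π : FaithfulIrrep A) (γ : A ≃⋆ₐ[ℂ] A) : FaithfulIrrep A where
  space := π.space
  toHom := π.toHom.comp (γ : A →⋆ₐ[ℂ] A)
  faithful := π.faithful.comp γ.injective
  nontrivial := π.nontrivial
  irreducible W hW h := π.irreducible W hW fun a ξ hξ => by
    obtain ⟨b, rfl⟩ := γ.surjective a
    exact h b ξ hξ

end FaithfulIrrep

/-- The faithful part of the spectrum of `A`: the set of unitary equivalence classes `[π]` of
faithful irreducible representations of `A`. -/
def FaithfulSpectrum (A : Type u) [CStarAlgebra A] : Type (u + 1) :=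
  Quotient (FaithfulIrrep.setoid A)

namespace FaithfulSpectrum

variable {A : Type u} [CStarAlgebra A]

/-- The class `[π]`. -/
def mk (π : FaithfulIrrep A) : FaithfulSpectrum A := Quotient.mk _ π

/-- The map `[π] ↦ [π ∘ γ]`, for a *-automorphism `γ`. -/
def comp (γ : A ≃⋆ₐ[ℂ] A) : FaithfulSpectrum A → FaithfulSpectrum A :=
  Quotient.map (fun π => π.comp γ) (by
    rintro π ρ ⟨U, hU⟩
    exact ⟨U, fun a ξ => hU (γ a) ξ⟩)

end FaithfulSpectrum

/-! ### The natural action -/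

section NaturalAction

variable {G : Type u} {K : Type v} [Group G] [Group K]

/-- `n` is a normalized section for `p : G → K`. -/
def IsNormalizedSection (p : G →* K) (n : K → G) : Prop :=
  (∀ k, p (n k) = k) ∧ n 1 = 1

/-- The automorphism `α_k` of `C*(H)`, `H = ker p`, determined by
`α_k(i_H(h)) = i_H(n(k) h n(k)⁻¹)`, for a section `n` for `p`. -/
def twistedAut (p : G →* K) (n : K → G) (k : K) : GroupCStar p.ker ≃⋆ₐ[ℂ] GroupCStar p.ker :=
  GroupCStar.congr (MulAut.conjNormal (n k))

/-- The natural action `k · [π] = [π ∘ α_{k⁻¹}]` of `K` on the faithful part of the spectrum of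
`C*(ker p)`, computed with the section `n` for `p`. -/
def naturalAct (p : G →* K) (n : K → G) (k : K) :
    FaithfulSpectrum (GroupCStar p.ker) → FaithfulSpectrum (GroupCStar p.ker) :=
  FaithfulSpectrum.comp (twistedAut p n k⁻¹)

/-- `x` is a free point for the natural action of `K`: `k · x ≠ x` for all `k ≠ e`, whichever
normalized section for `p` is used to compute the action. -/
def IsFreePoint (p : G →* K) (x : FaithfulSpectrum (GroupCStar p.ker)) : Prop :=
  ∀ n : K → G, IsNormalizedSection p n → ∀ k : K, k ≠ 1 → naturalAct p n k x ≠ x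

end NaturalAction

/-! ### The kernel of `G₁ * G₂ → G₁ × G₂` -/

section FreeProduct

open Monoid.Coprod

variable (G₁ : Type u) (G₂ : Type v) [Group G₁] [Group G₂]

/-- The kernel `H` of the canonical homomorphism from the free product `G₁ * G₂` onto
`G₁ × G₂`. -/
abbrev cartesianSubgroup : Subgroup (Monoid.Coprod G₁ G₂) :=
  (toProd : Monoid.Coprod G₁ G₂ →* G₁ × G₂).ker

variable {G₁ G₂}

/-- The commutator `[a, b] = a b a⁻¹ b⁻¹`, for nontrivial `a ∈ G₁` and `b ∈ G₂`, as an element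
of `H`. -/
def commGen (x : {a : G₁ // a ≠ 1} × {b : G₂ // b ≠ 1}) : cartesianSubgroup G₁ G₂ :=
  ⟨inl x.1.1 * inr x.2.1 * (inl x.1.1)⁻¹ * (inr x.2.1)⁻¹, by
    simp [MonoidHom.mem_ker]⟩

variable (G₁ G₂)

/-- The set `X` of all these commutators. -/
def commGens : Set (cartesianSubgroup G₁ G₂) := Set.range commGen

end FreeProduct

/-- The operator `T` is diagonal relative to some orthonormal (Hilbert) basis. -/
def IsDiagonalizableOp {V : Type u} [NormedAddCommGroup V] [InnerProductSpace ℂ V]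
    (T : V →L[ℂ] V) : Prop :=
  ∃ (ι : Type u) (b : HilbertBasis ι ℂ V) (μ : ι → ℂ), ∀ i, T (b i) = μ i • b i

/-- `π` is a Choi representation of `C*(H)` relative to the set `X` of generators of `H`: for
some `x₀ ∈ X`, the operator `π(i_H(x))` is diagonal relative to some orthonormal basis, which
may depend on `x`, for each `x ∈ X` other than `x₀`. -/
def IsChoiRep {H : Type u} [Group H] (X : Set H) (π : FaithfulIrrep (GroupCStar H)) : Prop :=
  ∃ x₀ ∈ X, ∀ x ∈ X, x ≠ x₀ → IsDiagonalizableOp (π.toHom (GroupCStar.of x))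

end

/-! Freeness of `H`. Every element of `G` is a product `f a b` with `f` a word in the commutators,
`a ∈ G₁`, `b ∈ G₂`. Right multiplication can be written formally on triples with `f` in the abstract
free group, and this is an action of `G`. Applying elements of `H` to the identity triple inverts
the map from the free group to `H` (`cartesianSubgroupEquiv`).

The Choi representation. For a free group, unitaries may be chosen independently on the generators.
Compressing them to a finite-dimensional space shows that finite-dimensional representations `σ n`
determine the norm (`exists_finiteDimensional_norm_le`). On the Hilbert sum of infinitely many
copies of each `σ n` every generator acts diagonally. Two generators are then perturbed: the
eigenvalues of `x₁` become distinct, by amounts tending to zero along the copies, and the operator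
of `x₀` is multiplied by a rank-one perturbation of the identity so that it maps one eigenvector of
`x₁` to a vector without zero coordinates. Both changes fade along the copies of `σ n`, so `σ n`
stays weakly contained and the representation is faithful (`norm_lift_apply_le`). The two perturbed
operators have no common reducing subspace (`eq_bot_or_eq_top_of_invariant`). Only `x₀` can lose
diagonality.

Freeness of the point. Let `χ` be the character of `H` extending `λ`, and suppose that `k` fixes `[π
∘ γ_χ]`. With `e` conjugation by a lift of `k⁻¹`, the operators `χ(h) π(h)` and `χ(e h) π(e h)` are
unitarily equivalent. Hence, if `π(h)` has an eigenvalue, `χ(e h * h⁻¹)` is a ratio of eigenvalues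
of operators in `π(H)` (`exists_eigenvalue_ratio`). By separability these ratios form a countable
set, which a generic `χ` avoids on all elements with a nonzero exponent sum
(`exists_generic_character`). It remains to see that each `k ≠ e` moves the class of some generator
other than `x₀` in the abelianization of `H` (`exists_exponentSum_conjNormal_ne`). Conjugation by
`(k₁, k₂)` sends the class of `[a, b]` to that of `[k₁, k₂] - [k₁a, k₂] + [k₁a, k₂b] - [k₁, k₂b]`,
which for nontrivial `k` can be `[a, b]` only if `(a, b) = (k₁, k₂)` and `k₁² = k₂² = 1`. The
cardinality hypothesis supplies a generator outside this exception. -/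

/-! ### The cartesian subgroup is free on the commutators -/

section CommutatorBasis

open Monoid.Coprod

variable {G₁ : Type u} {G₂ : Type v} [Group G₁] [Group G₂]

open Classical in
/-- The letter of the free group attached to a pair `(a, b)`; trivial if `a = 1` or `b = 1`. -/
noncomputable def commLetter (a : G₁) (b : G₂) :
    FreeGroup ({a : G₁ // a ≠ 1} × {b : G₂ // b ≠ 1}) :=
  if h : a ≠ 1 ∧ b ≠ 1 then FreeGroup.of (⟨a, h.1⟩, ⟨b, h.2⟩) else 1

theorem commLetter_one_left (b : G₂) : commLetter (1 : G₁) b = 1 := dif_neg (by simp)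

theorem commLetter_one_right (a : G₁) : commLetter a (1 : G₂) = 1 := dif_neg (by simp)

theorem commLetter_of (x : {a : G₁ // a ≠ 1} × {b : G₂ // b ≠ 1}) :
    commLetter x.1.1 x.2.1 = FreeGroup.of x :=
  dif_pos ⟨x.1.2, x.2.2⟩

theorem lift_commGen_commLetter (a : G₁) (b : G₂) :
    (FreeGroup.lift commGen (commLetter a b) : cartesianSubgroup G₁ G₂).1 =
      inl a * inr b * (inl a)⁻¹ * (inr b)⁻¹ := by
  by_cases ha : a = 1
  · subst ha; simp [commLetter_one_left]
  by_cases hb : b = 1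
  · subst hb; simp [commLetter_one_right]
  rw [commLetter, dif_pos ⟨ha, hb⟩, FreeGroup.lift_apply_of]
  rfl

variable (G₁ G₂) in
/-- The set of normal forms `f a b`, with `f` in the free group on the commutators. -/
abbrev NormalForm : Type (max u v) :=
  FreeGroup ({a : G₁ // a ≠ 1} × {b : G₂ // b ≠ 1}) × G₁ × G₂

/-- The action of `G₁ * G₂` on normal forms corresponding to multiplication by `g⁻¹` on the
right. -/
noncomputable def normalFormAct : Monoid.Coprod G₁ G₂ →* Equiv.Perm (NormalForm G₁ G₂) :=
  lift
    (MonoidHom.toHomPerm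
      -- In the group, `a b c⁻¹ = [a, b] [a c⁻¹, b]⁻¹ (a c⁻¹) b`; in a product of two such moves the
      -- middle letters cancel.
      { toFun c := fun w =>
          (w.1 * commLetter w.2.1 w.2.2 * (commLetter (w.2.1 * c⁻¹) w.2.2)⁻¹, w.2.1 * c⁻¹, w.2.2)
        map_one' := by funext w; simp; rfl
        map_mul' c d := by
          funext w
          change _ = (_, _, _)
          simp [mul_assoc] })
    (MonoidHom.toHomPerm
      { toFun c := fun w => (w.1, w.2.1, w.2.2 * c⁻¹)
        map_one' := by funext w; simp; rfl
        map_mul' c d := by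
          funext w
          change _ = (_, _, _)
          simp [mul_assoc] })

theorem normalFormAct_inl (c : G₁) (w : NormalForm G₁ G₂) :
    normalFormAct (inl c) w =
      (w.1 * commLetter w.2.1 w.2.2 * (commLetter (w.2.1 * c⁻¹) w.2.2)⁻¹, w.2.1 * c⁻¹, w.2.2) := by
  rw [normalFormAct, lift_apply_inl]; rfl

theorem normalFormAct_inr (c : G₂) (w : NormalForm G₁ G₂) :
    normalFormAct (inr c) w = (w.1, w.2.1, w.2.2 * c⁻¹) := by
  rw [normalFormAct, lift_apply_inr]; rfl

/-- Evaluation of normal forms in `G₁ * G₂`. -/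
noncomputable def evalNormalForm (w : NormalForm G₁ G₂) : Monoid.Coprod G₁ G₂ :=
  (FreeGroup.lift commGen w.1 : cartesianSubgroup G₁ G₂).1 * inl w.2.1 * inr w.2.2

theorem evalNormalForm_act (g : Monoid.Coprod G₁ G₂) (w : NormalForm G₁ G₂) :
    evalNormalForm (normalFormAct g w) = evalNormalForm w * g⁻¹ := by
  induction g using Monoid.Coprod.induction_on generalizing w with
  | inl c =>
    rw [normalFormAct_inl]
    simp only [evalNormalForm, map_mul, map_inv, Subgroup.coe_mul, Subgroup.coe_inv,
      lift_commGen_commLetter]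
    group
  | inr c => simp [normalFormAct_inr, evalNormalForm, mul_assoc]
  | mul g h hg hh => rw [map_mul, Equiv.Perm.mul_apply, hg, hh]; group

/-- Multiplications on the left and on the right commute. This makes the free-group component
multiplicative on `H`. -/
theorem normalFormAct_mul_left (g : Monoid.Coprod G₁ G₂) (f) (w : NormalForm G₁ G₂) :
    normalFormAct g (f * w.1, w.2) = (f * (normalFormAct g w).1, (normalFormAct g w).2) := by
  induction g using Monoid.Coprod.induction_on generalizing w with
  | inl c => simp [normalFormAct_inl, mul_assoc]
  | inr c => simp [normalFormAct_inr]
  | mul g h hg hh => rw [map_mul, Equiv.Perm.mul_apply, hh, hg, Equiv.Perm.mul_apply]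

theorem normalFormAct_snd (g : Monoid.Coprod G₁ G₂) (w : NormalForm G₁ G₂) :
    (normalFormAct g w).2 = w.2 * (toProd g)⁻¹ := by
  induction g using Monoid.Coprod.induction_on generalizing w with
  | inl c => simp [normalFormAct_inl, Prod.ext_iff]
  | inr c => simp [normalFormAct_inr, Prod.ext_iff]
  | mul g h hg hh => rw [map_mul, Equiv.Perm.mul_apply, hg, hh, map_mul]; group

variable (G₁ G₂) in
/-- The isomorphism from the cartesian subgroup onto the free group on the commutators. -/
noncomputable def cartesianSubgroupEquiv : cartesianSubgroup G₁ G₂ ≃*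
    FreeGroup ({a : G₁ // a ≠ 1} × {b : G₂ // b ≠ 1}) :=
  MulEquiv.symm
  { toFun := FreeGroup.lift commGen
    map_mul' := map_mul _
    invFun h := (normalFormAct h.1⁻¹ 1).1
    left_inv f := by
      have key (h h' : cartesianSubgroup G₁ G₂) : (normalFormAct (h * h').1⁻¹ 1).1 =
          (normalFormAct h.1⁻¹ 1).1 * (normalFormAct h'.1⁻¹ 1).1 := by
        -- Elements of `H` fix the `G₁ × G₂` component, so the image of the identity triple is a
        -- left translate of it.
        have hs : normalFormAct h.1⁻¹ 1 = ((normalFormAct h.1⁻¹ 1).1 * 1, 1) := by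
          have h1 : toProd h.1 = 1 := h.2
          refine Prod.ext (by simp) ?_
          rw [normalFormAct_snd, map_inv, h1]; simp
        rw [Subgroup.coe_mul, mul_inv_rev, map_mul, Equiv.Perm.mul_apply, hs]
        rw [show (1 : G₁ × G₂) = (1 : NormalForm G₁ G₂).2 from rfl,
          show (1 : FreeGroup ({a : G₁ // a ≠ 1} × {b : G₂ // b ≠ 1})) =
            (1 : NormalForm G₁ G₂).1 from rfl, normalFormAct_mul_left]
        simp
      let θ : cartesianSubgroup G₁ G₂ →* FreeGroup ({a : G₁ // a ≠ 1} × {b : G₂ // b ≠ 1}) :=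
        MonoidHom.mk' (fun h => (normalFormAct h.1⁻¹ 1).1) key
      change (θ.comp (FreeGroup.lift commGen)) f = MonoidHom.id _ f
      congr 1
      ext x
      -- Multiplying the identity by `a`, `b`, `a⁻¹`, `b⁻¹` in turn creates a single nontrivial
      -- letter, at the step `a⁻¹`.
      change (normalFormAct (FreeGroup.lift commGen (FreeGroup.of x)).1⁻¹ 1).1 = FreeGroup.of x
      rw [FreeGroup.lift_apply_of]
      simp only [commGen, mul_inv_rev, inv_inv, map_mul, Equiv.Perm.mul_apply, ← map_inv]
      simp only [normalFormAct_inl, normalFormAct_inr, Prod.fst_one, Prod.snd_one, inv_inv,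
        one_mul, mul_inv_cancel, commLetter_one_left, commLetter_one_right, commLetter_of, inv_one,
        mul_one]
    right_inv h := by
      have h1 := evalNormalForm_act h.1⁻¹ 1
      have h2 : (normalFormAct h.1⁻¹ (1 : NormalForm G₁ G₂)).2 = 1 := by
        have h1 : toProd h.1 = 1 := h.2
        rw [normalFormAct_snd, map_inv, h1]; simp
      ext
      rw [evalNormalForm, h2] at h1
      simpa only [evalNormalForm, Prod.fst_one, Prod.snd_one, map_one, mul_one, Subgroup.coe_one,
        one_mul, inv_inv] using h1 }

variable (G₁ G₂) in
/-- The cartesian subgroup is free on the commutators `[a, b]`. -/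
noncomputable def cartesianSubgroupBasis :
    FreeGroupBasis ({a : G₁ // a ≠ 1} × {b : G₂ // b ≠ 1}) (cartesianSubgroup G₁ G₂) :=
  .ofRepr (cartesianSubgroupEquiv G₁ G₂)

theorem cartesianSubgroupBasis_apply (x : {a : G₁ // a ≠ 1} × {b : G₂ // b ≠ 1}) :
    cartesianSubgroupBasis G₁ G₂ x = commGen x :=
  FreeGroup.lift_apply_of

end CommutatorBasis

/-! ### Integrated representations and twists by characters -/

namespace UnitaryRep

variable {H : Type u} [Group H]

/-- The twist of a unitary representation by a character. -/
noncomputable def twist (χ : H →* Circle) (ρ : UnitaryRep H) : UnitaryRep H where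
  space := ρ.space
  toHom :=
    { toFun h := ⟨(χ h : ℂ) • (ρ.toHom h : ρ.space →L[ℂ] ρ.space), by
        have h1 : (starRingEnd ℂ) (χ h : ℂ) * (χ h : ℂ) = 1 := by
          rw [← Circle.coe_inv_eq_conj, ← Circle.coe_mul, inv_mul_cancel, Circle.coe_one]
        have h2 := mul_comm (χ h : ℂ) _ ▸ h1
        rw [Unitary.mem_iff, star_smul]
        simp [smul_smul, h1, h2]⟩
      map_one' := by ext; simp
      map_mul' g h := by ext; simp [smul_smul, mul_comm] }

end UnitaryRep

namespace GroupCStar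

open UniformSpace

variable {H : Type u} [Group H]

theorem ofPre_single (h : H) (c : ℂ) : ofPre (PreGroupCStar.single h c) = c • of h := by
  rw [of, ← map_smul, PreGroupCStar.smul_single, mul_one]

theorem of_mul (g h : H) : of (g * h) = of g * of h := by
  rw [of, of, of, ← map_mul, PreGroupCStar.single_mul, one_mul]

section Lift

variable (ρ : UnitaryRep H)

theorem continuous_preLift : Continuous (PreGroupCStar.lift ρ) :=
  AddMonoidHomClass.continuous_of_bound (PreGroupCStar.lift ρ) 1 fun f => by
    rw [one_mul]; exact PreGroupCStar.le_maxNorm ρ f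

/-- The ring homomorphism on `C*(H)` integrating a unitary representation of `H`. -/
noncomputable def liftRingHom : GroupCStar H →+* (ρ.space →L[ℂ] ρ.space) :=
  Completion.extensionHom (PreGroupCStar.lift ρ : PreGroupCStar H →+* _) (continuous_preLift ρ)

theorem liftRingHom_ofPre (f : PreGroupCStar H) :
    liftRingHom ρ (ofPre f) = PreGroupCStar.lift ρ f :=
  Completion.extensionHom_coe _ (continuous_preLift ρ) f

theorem continuous_liftRingHom : Continuous (liftRingHom ρ) :=
  Completion.continuous_extension

/-- The representation of `C*(H)` integrating a unitary representation of `H`. -/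
noncomputable def lift : GroupCStar H →⋆ₐ[ℂ] (ρ.space →L[ℂ] ρ.space) where
  __ := liftRingHom ρ
  commutes' c := by
    change liftRingHom ρ (algebraMap ℂ _ c) = _
    rw [← AlgHom.commutes ofPre, liftRingHom_ofPre, AlgHom.commutes]
  map_star' x := by
    change liftRingHom ρ (star x) = star (liftRingHom ρ x)
    induction x using induction with
    | hP =>
      have := continuous_liftRingHom ρ
      exact isClosed_eq (by fun_prop) (by fun_prop)
    | h f => rw [star_ofPre, liftRingHom_ofPre, liftRingHom_ofPre, PreGroupCStar.lift_star]

theorem lift_ofPre (f : PreGroupCStar H) : lift ρ (ofPre f) = PreGroupCStar.lift ρ f :=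
  liftRingHom_ofPre ρ f

theorem continuous_lift : Continuous (lift ρ) := continuous_liftRingHom ρ

theorem lift_of (h : H) : lift ρ (of h) = (ρ.toHom h : ρ.space →L[ℂ] ρ.space) := by
  rw [of, lift_ofPre, PreGroupCStar.lift_single, one_smul]

end Lift

section Twist

variable (χ : H →* Circle)

/-- The automorphism of the group algebra given by pointwise multiplication by a character. -/
noncomputable def preTwist : PreGroupCStar H →ₐ[ℂ] PreGroupCStar H :=
  MonoidAlgebra.lift ℂ _ H
    { toFun h := PreGroupCStar.single h (χ h : ℂ)
      map_one' := by rw [map_one]; rfl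
      map_mul' g h := by rw [map_mul, Circle.coe_mul, PreGroupCStar.single_mul] }

theorem preTwist_single (h : H) (c : ℂ) :
    preTwist χ (PreGroupCStar.single h c) = PreGroupCStar.single h (c * χ h) :=
  (MonoidAlgebra.lift_single _ _ _).trans (PreGroupCStar.smul_single _ _ _)

theorem preTwist_star (f : PreGroupCStar H) : preTwist χ (star f) = star (preTwist χ f) := by
  induction f using PreGroupCStar.induction with
  | zero => simp
  | add f g hf hg => simp only [star_add, map_add, hf, hg]
  | single h c =>
    rw [PreGroupCStar.star_single, preTwist_single, preTwist_single, PreGroupCStar.star_single,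
      star_mul', map_inv, Circle.coe_inv_eq_conj]
    rfl

theorem lift_preTwist (ρ : UnitaryRep H) (f : PreGroupCStar H) :
    PreGroupCStar.lift ρ (preTwist χ f) = PreGroupCStar.lift (ρ.twist χ) f := by
  induction f using PreGroupCStar.induction with
  | zero => rw [map_zero, map_zero]; exact (map_zero _).symm
  | add f g hf hg => rw [map_add, map_add, hf, hg]; exact (map_add _ _ _).symm
  | single h c =>
    rw [preTwist_single, PreGroupCStar.lift_single, PreGroupCStar.lift_single]
    exact mul_smul _ _ _

theorem continuous_preTwist : Continuous (preTwist χ) :=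
  AddMonoidHomClass.continuous_of_bound (preTwist χ) 1 fun f => by
    rw [one_mul]
    exact PreGroupCStar.maxNorm_le (norm_nonneg _) fun ρ => by
      rw [lift_preTwist]
      exact PreGroupCStar.le_maxNorm _ f

theorem preTwist_preTwist_inv (f : PreGroupCStar H) : preTwist χ (preTwist χ⁻¹ f) = f := by
  induction f using PreGroupCStar.induction with
  | zero => simp
  | add f g hf hg => rw [map_add, map_add, hf, hg]
  | single h c =>
    rw [preTwist_single, preTwist_single, mul_assoc, ← Circle.coe_mul, MonoidHom.inv_apply,
      inv_mul_cancel, Circle.coe_one, mul_one]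

/-- The ring endomorphism of `C*(H)` with `i_H(h) ↦ χ(h) i_H(h)`. -/
noncomputable def twistRingHom : GroupCStar H →+* GroupCStar H :=
  Completion.mapRingHom (preTwist χ : PreGroupCStar H →+* PreGroupCStar H) (continuous_preTwist χ)

theorem twistRingHom_ofPre (f : PreGroupCStar H) :
    twistRingHom χ (ofPre f) = ofPre (preTwist χ f) :=
  Completion.mapRingHom_coe (f := (preTwist χ : PreGroupCStar H →+* PreGroupCStar H))
    (continuous_preTwist χ) f

theorem continuous_twistRingHom : Continuous (twistRingHom χ) :=
  Completion.continuous_map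

theorem twistRingHom_twistRingHom_inv (x : GroupCStar H) :
    twistRingHom χ (twistRingHom χ⁻¹ x) = x := by
  induction x using induction with
  | hP =>
    have h₁ := continuous_twistRingHom χ
    have h₂ := continuous_twistRingHom χ⁻¹
    exact isClosed_eq (by fun_prop) (by fun_prop)
  | h f => rw [twistRingHom_ofPre, twistRingHom_ofPre, preTwist_preTwist_inv]

/-- The *-automorphism of `C*(H)` with `i_H(h) ↦ χ(h) i_H(h)`. -/
noncomputable def twist : GroupCStar H ≃⋆ₐ[ℂ] GroupCStar H where
  toFun := twistRingHom χ
  invFun := twistRingHom χ⁻¹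
  left_inv x := by simpa using twistRingHom_twistRingHom_inv χ⁻¹ x
  right_inv := twistRingHom_twistRingHom_inv χ
  map_mul' := map_mul _
  map_add' := map_add _
  map_star' x := by
    induction x using induction with
    | hP =>
      have := continuous_twistRingHom χ
      exact isClosed_eq (by fun_prop) (by fun_prop)
    | h f => rw [star_ofPre, twistRingHom_ofPre, twistRingHom_ofPre, star_ofPre, preTwist_star]
  map_smul' c x := by
    induction x using induction with
    | hP =>
      have := continuous_twistRingHom χ
      have h₁ := continuous_const_smul (T := GroupCStar H) c
      exact isClosed_eq (this.comp h₁) (h₁.comp this)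
    | h f => rw [← map_smul, twistRingHom_ofPre, twistRingHom_ofPre, map_smul, map_smul]

theorem twist_of (h : H) : twist χ (of h) = (χ h : ℂ) • of h := by
  rw [← ofPre_single]
  refine (twistRingHom_ofPre χ _).trans ?_
  rw [preTwist_single, one_mul]

end Twist

end GroupCStar

/-! ### Residual finite-dimensionality for free groups -/

namespace UnitaryRep

variable {H : Type u} [Group H] {X : Type v}

theorem toHom_mul_apply (ρ : UnitaryRep H) (g h : H) (ξ : ρ.space) :
    (ρ.toHom (g * h)).1 ξ = (ρ.toHom g).1 ((ρ.toHom h).1 ξ) := by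
  rw [map_mul]; rfl

theorem toHom_inv_apply (ρ : UnitaryRep H) (h : H) (ξ : ρ.space) :
    (ρ.toHom h⁻¹).1 ((ρ.toHom h).1 ξ) = ξ := by
  rw [← toHom_mul_apply, inv_mul_cancel, map_one]; rfl

theorem toHom_apply_inv (ρ : UnitaryRep H) (h : H) (ξ : ρ.space) :
    (ρ.toHom h).1 ((ρ.toHom h⁻¹).1 ξ) = ξ := by
  rw [← toHom_mul_apply, mul_inv_cancel, map_one]; rfl

/-- The unitary representation of a free group with prescribed values on a basis. -/
noncomputable abbrev ofBasis (B : FreeGroupBasis X H) {E : Type u} [NormedAddCommGroup E]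
    [InnerProductSpace ℂ E] [CompleteSpace E] (V : X → unitary (E →L[ℂ] E)) : UnitaryRep H where
  space := E
  toHom := B.lift V

theorem ofBasis_toHom (B : FreeGroupBasis X H) {E : Type u} [NormedAddCommGroup E]
    [InnerProductSpace ℂ E] [CompleteSpace E] (V : X → unitary (E →L[ℂ] E)) (x : X) :
    (ofBasis B V).toHom (B x) = V x :=
  congr_fun (B.lift.symm_apply_apply V) x

theorem _root_.FreeGroupBasis.induction (B : FreeGroupBasis X H) {P : H → Prop} (h : H)
    (one : P 1) (basis : ∀ x, P (B x)) (inv : ∀ x, P (B x) → P (B x)⁻¹)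
    (mul : ∀ g h, P g → P h → P (g * h)) : P h := by
  suffices key : ∀ w : FreeGroup X, P (B.repr.symm w) by simpa using key (B.repr h)
  intro w
  induction w using FreeGroup.induction_on with
  | C1 => simpa using one
  | of x => exact basis x
  | inv_of x hx => rw [map_inv]; exact inv x hx
  | mul g h hg hh => rw [map_mul]; exact mul _ _ hg hh

/-- A unitary operator `U` can be compressed to a finite-dimensional subspace `F`: there is a
unitary operator on `F` that agrees with `U` wherever `U` does not leave `F`. -/
theorem exists_unitary_compression {V : Type u} [NormedAddCommGroup V] [InnerProductSpace ℂ V]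
    [CompleteSpace V] (U : unitary (V →L[ℂ] V)) (F : Submodule ℂ V) [FiniteDimensional ℂ F] :
    ∃ W : unitary (F →L[ℂ] F), ∀ ξ : F, (U : V →L[ℂ] V) ξ ∈ F →
      ((W : F →L[ℂ] F) ξ : V) = (U : V →L[ℂ] V) ξ := by
  let T : F →ₗ[ℂ] V := (U : V →L[ℂ] V).toLinearMap.comp F.subtype
  let S : Submodule ℂ F := F.comap T
  let L : S →ₗᵢ[ℂ] F :=
    { toLinearMap := (T.comp S.subtype).codRestrict F fun ξ => ξ.2
      norm_map' := fun ξ => Unitary.norm_map U _ }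
  -- A partial isometry of a finite-dimensional space extends to an isometry, which is onto by
  -- dimension.
  let W := L.extend.toLinearIsometryEquiv rfl
  refine ⟨Unitary.linearIsometryEquiv.symm W, fun ξ hξ => ?_⟩
  exact congrArg Subtype.val (L.extend_apply ⟨ξ, hξ⟩)

variable (B : FreeGroupBasis X H) (ρ : UnitaryRep H)

/-- Unitary operators on a subspace which agree with the generators of `ρ(H)` wherever these do
not leave the subspace. -/
def IsCompression (F : Submodule ℂ ρ.space) [FiniteDimensional ℂ F]
    (W : X → unitary (F →L[ℂ] F)) : Prop :=
  ∀ (x : X) (ξ : F), (ρ.toHom (B x) : ρ.space →L[ℂ] ρ.space) ξ ∈ F →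
    ((W x : F →L[ℂ] F) ξ : ρ.space) = (ρ.toHom (B x) : ρ.space →L[ℂ] ρ.space) ξ

variable {B ρ}

/-- Computing `ρ(h) ξ` letter by letter visits finitely many vectors. Once `F` contains them all,
the compressed unitaries follow the same path. -/
theorem exists_compression_apply (h : H) (ξ : ρ.space) :
    ∃ F₀ : Submodule ℂ ρ.space, FiniteDimensional ℂ F₀ ∧
      ∀ (F : Submodule ℂ ρ.space) [FiniteDimensional ℂ F] (W : X → unitary (F →L[ℂ] F)),
        F₀ ≤ F → IsCompression B ρ F W → ∀ hξ : ξ ∈ F,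
          F.subtype (((ofBasis B W).toHom h).1 ⟨ξ, hξ⟩) =
            (ρ.toHom h : ρ.space →L[ℂ] ρ.space) ξ := by
  induction h using B.induction generalizing ξ with
  | one => exact ⟨⊥, inferInstance, fun F _ W _ _ hξ => by
    rw [map_one, map_one]; rfl⟩
  | basis x =>
    refine ⟨Submodule.span ℂ {(ρ.toHom (B x) : ρ.space →L[ℂ] ρ.space) ξ}, inferInstance,
      fun F _ W hF hW hξ => ?_⟩
    rw [ofBasis_toHom]
    exact hW x ⟨ξ, hξ⟩ (hF (Submodule.mem_span_singleton_self _))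
  | inv x =>
    refine ⟨Submodule.span ℂ {(ρ.toHom (B x)⁻¹ : ρ.space →L[ℂ] ρ.space) ξ}, inferInstance,
      fun F _ W hF hW hξ => ?_⟩
    -- The compression at `x` agrees with `ρ` on `ρ(x)⁻¹ ξ`, which lies in `F` and is mapped to `ξ ∈
    -- F`; invertibility then gives the value of its inverse at `ξ`.
    have hη := hF (Submodule.mem_span_singleton_self _)
    have h1 := ρ.toHom_apply_inv (B x) ξ
    have h2 := hW x ⟨_, hη⟩ (by simpa only [h1] using hξ)
    rw [← ofBasis_toHom B W] at h2
    have h3 : ((ofBasis B W).toHom (B x)).1 ⟨_, hη⟩ = (⟨ξ, hξ⟩ : F) := Subtype.ext (h2.trans h1)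
    rw [← h3]
    exact congrArg F.subtype (toHom_inv_apply (ofBasis B W) (B x) _)
  | mul g h hg hh =>
    obtain ⟨F₁, _, h₁⟩ := hh ξ
    obtain ⟨F₂, _, h₂⟩ := hg ((ρ.toHom h : ρ.space →L[ℂ] ρ.space) ξ)
    refine ⟨F₁ ⊔ F₂, inferInstance, fun F _ W hF hW hξ => ?_⟩
    have h3 := h₁ F W (le_sup_left.trans hF) hW hξ
    have h4 : (ρ.toHom h : ρ.space →L[ℂ] ρ.space) ξ ∈ F := h3 ▸ Subtype.property _
    have h5 := h₂ F W (le_sup_right.trans hF) hW h4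
    rw [toHom_mul_apply, toHom_mul_apply, ← h5]
    exact congrArg (fun η : F => F.subtype (((ofBasis B W).toHom g).1 η)) (Subtype.ext h3)

theorem exists_compression_lift_apply (f : PreGroupCStar H) (ξ : ρ.space) :
    ∃ F₀ : Submodule ℂ ρ.space, FiniteDimensional ℂ F₀ ∧
      ∀ (F : Submodule ℂ ρ.space) [FiniteDimensional ℂ F] (W : X → unitary (F →L[ℂ] F)),
        F₀ ≤ F → IsCompression B ρ F W → ∀ hξ : ξ ∈ F,
          F.subtype ((PreGroupCStar.lift (ofBasis B W) f : F →L[ℂ] F) ⟨ξ, hξ⟩) =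
            PreGroupCStar.lift ρ f ξ := by
  induction f using PreGroupCStar.induction with
  | zero =>
    refine ⟨⊥, inferInstance, fun F _ W _ _ hξ => ?_⟩
    rw [map_zero, map_zero]; rfl
  | add f g hf hg =>
    obtain ⟨F₁, _, h₁⟩ := hf
    obtain ⟨F₂, _, h₂⟩ := hg
    refine ⟨F₁ ⊔ F₂, inferInstance, fun F _ W hF hW hξ => ?_⟩
    rw [map_add, map_add, add_apply, add_apply,
      ← h₁ F W (le_sup_left.trans hF) hW hξ, ← h₂ F W (le_sup_right.trans hF) hW hξ]
    rfl
  | single h c =>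
    obtain ⟨F₁, _, h₁⟩ := exists_compression_apply (B := B) h ξ
    refine ⟨F₁, inferInstance, fun F _ W hF hW hξ => ?_⟩
    rw [PreGroupCStar.lift_single, PreGroupCStar.lift_single, smul_apply, smul_apply,
      ← h₁ F W hF hW hξ]
    rfl

/-- The full C*-algebra of a free group is residually finite-dimensional. -/
theorem exists_finiteDimensional_norm_le (B : FreeGroupBasis X H) (f : PreGroupCStar H) :
    ∃ (σ : UnitaryRep H) (_ : FiniteDimensional ℂ σ.space) (ξ : σ.space),
      ‖ξ‖ ≤ 1 ∧ ‖f‖ ≤ 2 * ‖PreGroupCStar.lift σ f ξ‖ := by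
  obtain ⟨ρ, ξ, h1, h2⟩ : ∃ (ρ : UnitaryRep H) (ξ : ρ.space),
      ‖ξ‖ ≤ 1 ∧ ‖f‖ ≤ 2 * ‖PreGroupCStar.lift ρ f ξ‖ := by
    -- The factor `2` only leaves room for a nearly norming vector, as the supremum need not be
    -- attained. The zero vector of a trivial representation turns the negated claim into `0 < ‖f‖`,
    -- which contradicts `‖f‖ ≤ ‖f‖ / 2`.
    by_contra! hcon
    have hle : ‖f‖ ≤ ‖f‖ / 2 := PreGroupCStar.maxNorm_le (by positivity) fun ρ => by
      refine ContinuousLinearMap.opNorm_le_of_unit_norm (by positivity) fun ξ hξ => ?_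
      linarith [hcon ρ ξ hξ.le]
    have := hcon ⟨EuclideanSpace ℂ PUnit, 1⟩ 0 (by simp)
    rw [map_zero, norm_zero] at this
    linarith
  obtain ⟨F₀, _, hF₀⟩ := exists_compression_lift_apply (B := B) f ξ
  let F := F₀ ⊔ Submodule.span ℂ {ξ}
  choose W hW using fun x => exists_unitary_compression (ρ.toHom (B x)) F
  have hξ : ξ ∈ F := Submodule.mem_sup_right (Submodule.mem_span_singleton_self _)
  refine ⟨ofBasis B W, inferInstanceAs (FiniteDimensional ℂ F), (⟨ξ, hξ⟩ : F), h1, ?_⟩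
  rw [← hF₀ F W le_sup_left hW hξ] at h2
  exact h2

end UnitaryRep

/-! ### Eigenbases, diagonal unitaries and separability -/

open Module in
/-- A unitary operator on a finite-dimensional complex Hilbert space has an orthonormal basis of
eigenvectors. -/
theorem exists_orthonormalBasis_eigenvectors {E : Type u} [NormedAddCommGroup E]
    [InnerProductSpace ℂ E] [CompleteSpace E] [FiniteDimensional ℂ E] (U : unitary (E →L[ℂ] E)) :
    ∃ (b : OrthonormalBasis (Fin (finrank ℂ E)) ℂ E) (μ : Fin (finrank ℂ E) → Circle),
      ∀ i, U.1 (b i) = (μ i : ℂ) • b i := by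
  let T : End ℂ E := U.1.toLinearMap
  have hin (v w : E) : inner ℂ (T v) (T w) = inner ℂ v w := Unitary.inner_map_map U v w
  have hno (v : E) : ‖T v‖ = ‖v‖ := Unitary.norm_map U v
  have hμ {μ : ℂ} {v : E} (hv : T v = μ • v) (h0 : v ≠ 0) : ‖μ‖ = 1 := by
    have := hno v
    rw [hv, norm_smul] at this
    exact (mul_eq_right₀ (norm_ne_zero_iff.2 h0)).1 this
  have hμ' {μ : ℂ} {v : E} (hv : T v = μ • v) (h0 : v ≠ 0) : starRingEnd ℂ μ * μ = 1 := by
    rw [mul_comm, Complex.mul_conj, Complex.normSq_eq_norm_sq, hμ hv h0]; simp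
  have hort : OrthogonalFamily ℂ (fun μ : End.Eigenvalues T => End.eigenspace T μ)
      fun μ => (End.eigenspace T μ).subtypeₗᵢ := by
    rintro ⟨μ, _⟩ ⟨ν, _⟩ hμν ⟨v, hv⟩ ⟨w, hw⟩
    change inner ℂ v w = 0
    by_cases h0 : v = 0
    · rw [h0, inner_zero_left]
    rw [End.mem_eigenspace_iff] at hv hw
    have h1 := hin v w
    change T v = μ • v at hv
    change T w = ν • w at hw
    rw [hv, hw, inner_smul_left, inner_smul_right, ← mul_assoc] at h1
    by_contra h2
    have h3 := (mul_eq_right₀ h2).1 h1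
    have h4 := hμ' hv h0
    apply hμν
    apply Subtype.ext
    change μ = ν
    calc μ = μ * (starRingEnd ℂ μ * ν) := by rw [h3, mul_one]
      _ = (starRingEnd ℂ μ * μ) * ν := by ring
      _ = ν := by rw [h4, one_mul]
  have hinv : ∀ v ∈ (⨆ μ : End.Eigenvalues T, End.eigenspace T μ)ᗮ,
      T v ∈ (⨆ μ : End.Eigenvalues T, End.eigenspace T μ)ᗮ := by
    intro v hv
    rw [← Submodule.iInf_orthogonal, Submodule.mem_iInf] at hv ⊢
    rintro μ w hw
    by_cases h0 : w = 0
    · simp [h0]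
    have h1 := hv μ w hw
    have h2 : T w = (μ : ℂ) • w := End.mem_eigenspace_iff.1 hw
    have h3 := hμ' h2 h0
    rw [← hin, h2, inner_smul_left] at h1
    refine (mul_eq_zero.1 h1).resolve_left fun h4 => ?_
    simp [h4] at h3
  have hbot : (⨆ μ : End.Eigenvalues T, End.eigenspace T μ)ᗮ = ⊥ := by
    rw [← Submodule.subsingleton_iff_eq_bot]
    by_contra hns
    rw [not_subsingleton_iff_nontrivial] at hns
    obtain ⟨c, hc⟩ := End.exists_eigenvalue (T.restrict hinv)
    obtain ⟨v, hv, h0⟩ := hc.exists_hasEigenvector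
    rw [End.mem_eigenspace_iff] at hv
    have hv' : T v = c • (v : E) := congrArg Subtype.val hv
    have h0' : (v : E) ≠ 0 := fun h => h0 (Subtype.ext h)
    have hc' : End.HasEigenvalue T c :=
      End.hasEigenvalue_of_hasEigenvector ⟨End.mem_eigenspace_iff.2 hv', h0'⟩
    have hmem : (v : E) ∈ ⨆ μ : End.Eigenvalues T, End.eigenspace T μ :=
      Submodule.mem_iSup_of_mem (p := fun μ : End.Eigenvalues T => End.eigenspace T μ) ⟨c, hc'⟩
        (End.mem_eigenspace_iff.2 hv')
    exact h0' (inner_self_eq_zero.1 (v.2 _ hmem))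
  have hds : DirectSum.IsInternal fun μ : End.Eigenvalues T => End.eigenspace T μ :=
    hort.isInternal_iff.2 hbot
  let b := hds.subordinateOrthonormalBasis rfl hort
  have hb (i) : T (b i) =
      ((hds.subordinateOrthonormalBasisIndex rfl i hort : End.Eigenvalues T) : ℂ) • b i :=
    End.mem_eigenspace_iff.1 (hds.subordinateOrthonormalBasis_subordinate rfl i hort)
  refine ⟨b, fun i => ⟨_, mem_sphere_zero_iff_norm.2 (hμ (hb i) ?_)⟩, hb⟩
  exact b.orthonormal.ne_zero i

namespace HilbertBasis

variable {V : Type u} [NormedAddCommGroup V] [InnerProductSpace ℂ V] {ι : Type w}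

theorem eq_zero_of_inner (b : HilbertBasis ι ℂ V) {v : V} (h : ∀ i, inner ℂ (b i) v = 0) :
    v = 0 := by
  apply b.repr.injective
  rw [map_zero]
  ext i
  rw [b.repr_apply_apply, h]; rfl

theorem ext_inner (b : HilbertBasis ι ℂ V) {v w : V} (h : ∀ i, inner ℂ (b i) v = inner ℂ (b i) w) :
    v = w :=
  sub_eq_zero.1 (b.eq_zero_of_inner fun i => by rw [inner_sub_right, h, sub_self])

theorem orthonormal_circle_smul (b : HilbertBasis ι ℂ V) (c : ι → Circle) :
    Orthonormal ℂ fun i => (c i : ℂ) • b i := by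
  refine ⟨fun i => by rw [norm_smul, b.orthonormal.1 i, Circle.norm_coe, mul_one],
    fun i j hij => ?_⟩
  change inner ℂ ((c i : ℂ) • b i) ((c j : ℂ) • b j) = 0
  rw [inner_smul_left, inner_smul_right, b.orthonormal.2 hij, mul_zero, mul_zero]

variable [CompleteSpace V]

/-- The Hilbert basis obtained by multiplying the vectors of a Hilbert basis by phases. -/
noncomputable def circleSMul (b : HilbertBasis ι ℂ V) (c : ι → Circle) : HilbertBasis ι ℂ V :=
  HilbertBasis.mkOfOrthogonalEqBot (b.orthonormal_circle_smul c) <| by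
    rw [Submodule.eq_bot_iff]
    intro v hv
    refine b.eq_zero_of_inner fun i => ?_
    have h := hv _ (Submodule.subset_span ⟨i, rfl⟩)
    rw [inner_smul_left] at h
    exact (mul_eq_zero.1 h).resolve_left (by simp)

theorem circleSMul_apply (b : HilbertBasis ι ℂ V) (c : ι → Circle) (i : ι) :
    b.circleSMul c i = (c i : ℂ) • b i :=
  congr_fun (HilbertBasis.coe_mkOfOrthogonalEqBot _ _) i

/-- The unitary operator which is diagonal in the Hilbert basis `b`, with eigenvalues `c i`. -/
noncomputable def diagonal (b : HilbertBasis ι ℂ V) (c : ι → Circle) : unitary (V →L[ℂ] V) :=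
  Unitary.linearIsometryEquiv.symm (b.repr.trans (b.circleSMul c).repr.symm)

theorem diagonal_apply (b : HilbertBasis ι ℂ V) (c : ι → Circle) (i : ι) :
    (b.diagonal c).1 (b i) = (c i : ℂ) • b i := by
  classical
  rw [← circleSMul_apply]
  change (b.circleSMul c).repr.symm (b.repr (b i)) = _
  rw [b.repr_self, HilbertBasis.repr_symm_single]

theorem isDiagonalizableOp {ι : Type} (b : HilbertBasis ι ℂ V) {T : V →L[ℂ] V} {c : ι → ℂ}
    (h : ∀ i, T (b i) = c i • b i) : IsDiagonalizableOp T := by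
  let b' : HilbertBasis (ULift.{u} ι) ℂ V :=
    HilbertBasis.mkOfOrthogonalEqBot (v := fun i => b i.down)
      (b.orthonormal.comp _ ULift.down_injective) <| by
      rw [Submodule.eq_bot_iff]
      exact fun v hv => b.eq_zero_of_inner fun i => hv _ (Submodule.subset_span ⟨⟨i⟩, rfl⟩)
  have hb' (i) : b' i = b i.down := congr_fun (HilbertBasis.coe_mkOfOrthogonalEqBot _ _) i
  exact ⟨_, b', fun i => c i.down, fun i => by rw [hb', h]⟩

end HilbertBasis

section EigenvaluesCountable

variable {V : Type u} [NormedAddCommGroup V] [InnerProductSpace ℂ V] [CompleteSpace V]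

/-- The point spectrum of a unitary operator on a separable Hilbert space is countable. -/
theorem countable_eigenvalues [TopologicalSpace.SeparableSpace V] (U : unitary (V →L[ℂ] V)) :
    {c : ℂ | ∃ ξ : V, ξ ≠ 0 ∧ U.1 ξ = c • ξ}.Countable := by
  have h (c : {c : ℂ | ∃ ξ : V, ξ ≠ 0 ∧ U.1 ξ = c • ξ}) : ∃ ξ : V, ‖ξ‖ = 1 ∧ U.1 ξ = c.1 • ξ := by
    obtain ⟨ξ, h0, hξ⟩ := c.2
    refine ⟨(‖ξ‖⁻¹ : ℂ) • ξ, by simp [norm_smul, h0], ?_⟩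
    rw [map_smul, hξ, smul_comm]
  choose ξ hξ hU using h
  have hnear (c) : ∃ n, dist (ξ c) (TopologicalSpace.denseSeq V n) < 1 / 2 :=
    (TopologicalSpace.denseRange_denseSeq V).exists_dist_lt (ξ c) (by norm_num)
  -- Unit eigenvectors for distinct eigenvalues are orthogonal, hence at distance `√2`, so they
  -- cannot both lie within `1 / 2` of the same point of a dense sequence.
  choose n hn using hnear
  refine Set.countable_coe_iff.1 (Function.Injective.countable (f := n) fun c d hcd => ?_)
  by_contra hne
  have hc : ‖c.1‖ = 1 := by
    have := Unitary.norm_map U (ξ c)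
    rw [hU, norm_smul, hξ, mul_one] at this
    exact this
  have hort : inner ℂ (ξ c) (ξ d) = 0 := by
    have h1 := Unitary.inner_map_map U (ξ c) (ξ d)
    rw [hU, hU, inner_smul_left, inner_smul_right, ← mul_assoc] at h1
    by_contra h2
    have h3 := (mul_eq_right₀ h2).1 h1
    have h4 : c.1 * starRingEnd ℂ c.1 = 1 := by
      rw [Complex.mul_conj, Complex.normSq_eq_norm_sq, hc]; simp
    apply hne
    apply Subtype.ext
    calc c.1 = c.1 * (starRingEnd ℂ c.1 * d.1) := by rw [h3, mul_one]
      _ = (c.1 * starRingEnd ℂ c.1) * d.1 := by ring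
      _ = d.1 := by rw [h4, one_mul]
  have hlt : ‖ξ c - ξ d‖ < 1 := by
    rw [← dist_eq_norm]
    have h1 := hn c
    have h2 := hn d
    rw [← hcd] at h2
    linarith [dist_triangle_right (ξ c) (ξ d) (TopologicalSpace.denseSeq V (n c))]
  have hsq := norm_sub_sq (𝕜 := ℂ) (ξ c) (ξ d)
  rw [hort, hξ, hξ] at hsq
  simp at hsq
  nlinarith [norm_nonneg (ξ c - ξ d)]

end EigenvaluesCountable

section HilbertSum

variable {α : Type w} [DecidableEq α] {E : α → Type u} [∀ a, NormedAddCommGroup (E a)]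
  [∀ a, InnerProductSpace ℂ (E a)]

/-- Orthonormal bases of the summands give a Hilbert basis of the Hilbert sum. -/
noncomputable def lp.hilbertBasis [∀ a, CompleteSpace (E a)] {κ : α → Type v}
    [∀ a, Fintype (κ a)] (b : ∀ a, OrthonormalBasis (κ a) ℂ (E a)) :
    HilbertBasis (Σ a, κ a) ℂ (lp E 2) :=
  HilbertBasis.mkOfOrthogonalEqBot (v := fun p => lp.single 2 p.1 (b p.1 p.2))
    (by
      classical
      rw [orthonormal_iff_ite]
      rintro ⟨a, i⟩ ⟨a', i'⟩
      rw [lp.inner_single_left]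
      by_cases h : a = a'
      · subst h
        rw [lp.single_apply_self, orthonormal_iff_ite.1 (b a).orthonormal]
        simp
      · rw [lp.single_apply_ne _ _ _ h, inner_zero_right, if_neg]
        rintro ⟨⟩
        exact h rfl) <| by
    rw [Submodule.eq_bot_iff]
    intro v hv
    ext a
    apply (b a).toHilbertBasis.ext_inner
    intro i
    have := hv _ (Submodule.subset_span ⟨⟨a, i⟩, rfl⟩)
    rw [lp.inner_single_left] at this
    simpa only [OrthonormalBasis.coe_toHilbertBasis, inner_zero_right, lp.coeFn_zero,
      Pi.zero_apply] using this

theorem lp.hilbertBasis_apply [∀ a, CompleteSpace (E a)] {κ : α → Type v} [∀ a, Fintype (κ a)]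
    (b : ∀ a, OrthonormalBasis (κ a) ℂ (E a)) (p : Σ a, κ a) :
    lp.hilbertBasis b p = lp.single 2 p.1 (b p.1 p.2) :=
  congr_fun (HilbertBasis.coe_mkOfOrthogonalEqBot _ _) p

theorem lp.separableSpace [Countable α] [∀ a, TopologicalSpace.SeparableSpace (E a)] :
    TopologicalSpace.SeparableSpace (lp E 2) := by
  have h1 : TopologicalSpace.IsSeparable
      (⋃ a, Set.range (lp.single (E := E) 2 a)) :=
    .iUnion fun a => TopologicalSpace.isSeparable_range (lp.isometry_single a).continuous
  rw [← TopologicalSpace.isSeparable_univ_iff]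
  refine (h1.span (R := ℂ)).closure.mono fun f _ => ?_
  refine mem_closure_of_tendsto (lp.hasSum_single (by simp) f) (.of_forall fun s => ?_)
  exact Submodule.sum_mem _ fun a _ => Submodule.subset_span (Set.mem_iUnion.2 ⟨a, _, rfl⟩)

end HilbertSum

theorem PreGroupCStar.separableSpace {H : Type u} [Group H] [Countable H] :
    TopologicalSpace.SeparableSpace (PreGroupCStar H) := by
  rw [← TopologicalSpace.isSeparable_univ_iff]
  have h1 := (Set.countable_range fun h : H => PreGroupCStar.single h 1).isSeparable
  refine (h1.span (R := ℂ)).mono fun f _ => ?_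
  induction f using PreGroupCStar.induction with
  | zero => exact Submodule.zero_mem _
  | add f g hf hg => exact Submodule.add_mem _ (hf trivial) (hg trivial)
  | single h c =>
    rw [← mul_one c, ← PreGroupCStar.smul_single]
    exact Submodule.smul_mem _ _ (Submodule.subset_span ⟨h, rfl⟩)

/-! ### Generic parameters, rank-one perturbation and irreducibility -/

section Generic

theorem Set.Countable.exists_real_notMem {S : Set ℝ} (hS : S.Countable) : ∃ t, t ∉ S := by
  by_contra! h
  rw [Set.eq_univ_of_forall h, Set.countable_univ_iff] at hS
  exact not_countable (α := ℝ) hS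

/-- The solutions form an arithmetic progression of step `2π / d`, if there are any. The lemma
serves to choose a real parameter that violates countably many equations at once. -/
theorem countable_circleExp_mul_eq {d : ℝ} (hd : d ≠ 0) (κ : ℂ) :
    {t : ℝ | (Circle.exp (t * d) : ℂ) = κ}.Countable := by
  rcases Set.eq_empty_or_nonempty {t : ℝ | (Circle.exp (t * d) : ℂ) = κ} with h | ⟨t₀, ht₀⟩
  · rw [h]; exact Set.countable_empty
  refine (Set.countable_range fun m : ℤ => (t₀ * d + m * (2 * Real.pi)) / d).mono fun t ht => ?_
  obtain ⟨m, hm⟩ := Circle.exp_eq_exp.1 (Circle.ext (ht.trans ht₀.symm))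
  exact ⟨m, by rw [div_eq_iff hd]; exact hm.symm⟩

theorem countable_add_mul_eq_zero {a d : ℂ} (h : a ≠ 0 ∨ d ≠ 0) :
    {s : ℝ | a + s * d = 0}.Countable := by
  refine Set.Subsingleton.countable fun s hs t ht => ?_
  have hs' : a + s * d = 0 := hs
  have ht' : a + t * d = 0 := ht
  have h1 : ((s : ℂ) - t) * d = 0 := by linear_combination hs' - ht'
  rcases mul_eq_zero.1 h1 with h2 | h2
  · exact_mod_cast sub_eq_zero.1 h2
  · subst h2
    simp_all

end Generic

section CyclicPerturbation

variable {V : Type u} [NormedAddCommGroup V] [InnerProductSpace ℂ V] {ι : Type w}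

theorem IsStarProjection.one_add_smul_mem_unitary {A : Type*} [Ring A] [StarRing A] [Algebra ℂ A]
    [StarModule ℂ A] {p : A} (hp : IsStarProjection p) (c : Circle) :
    1 + ((c : ℂ) - 1) • p ∈ unitary A := by
  have h1 : p * p = p := hp.isIdempotentElem
  have h2 : star p = p := hp.isSelfAdjoint
  have h3 : star (c : ℂ) * c = 1 := by
    rw [Complex.star_def, ← Circle.coe_inv_eq_conj, ← Circle.coe_mul, inv_mul_cancel,
      Circle.coe_one]
  rw [Unitary.mem_iff]
  simp only [star_add, star_one, star_smul, star_sub, h2, mul_add, add_mul, one_mul, mul_one,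
    smul_mul_smul_comm, h1]
  constructor
  · rw [add_assoc, ← add_smul, ← add_smul,
      show star (c : ℂ) - 1 + ((c : ℂ) - 1 + (star (c : ℂ) - 1) * ((c : ℂ) - 1)) = 0 by
        linear_combination h3, zero_smul, add_zero]
  · rw [add_assoc, ← add_smul, ← add_smul,
      show (c : ℂ) - 1 + (star (c : ℂ) - 1 + ((c : ℂ) - 1) * (star (c : ℂ) - 1)) = 0 by
        linear_combination h3, zero_smul, add_zero]

/-- There is a vector with nonzero coordinates in a given countable Hilbert basis which is not
orthogonal to a given nonzero vector. -/
theorem HilbertBasis.exists_coord_ne_zero [Countable ι] (b : HilbertBasis ι ℂ V) {u : V}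
    (hu : u ≠ 0) : ∃ z : V, ‖z‖ = 1 ∧ inner ℂ z u ≠ 0 ∧ ∀ i, inner ℂ (b i) z ≠ 0 := by
  obtain ⟨code, hcode⟩ := exists_injective_nat ι
  -- Geometric decay along an enumeration gives nonzero square-summable coordinates.
  let g : ι → ℂ := fun i => (1 / 2) ^ code i
  have hg : Memℓp (E := fun _ : ι => ℂ) g 2 := by
    refine memℓp_gen ?_
    have h1 : Summable fun n : ℕ => ((1 : ℝ) / 4) ^ n :=
      summable_geometric_of_lt_one (by norm_num) (by norm_num)
    refine (h1.comp_injective hcode).congr fun i => ?_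
    simp only [g, Function.comp, norm_pow, norm_div, norm_one, Complex.norm_ofNat,
      ENNReal.toReal_ofNat, Real.rpow_ofNat]
    rw [← pow_mul, mul_comm, pow_mul]
    norm_num
  let z₀ : V := b.repr.symm ⟨g, hg⟩
  have hz₀ (i) : inner ℂ (b i) z₀ ≠ 0 := by
    rw [← b.repr_apply_apply, LinearIsometryEquiv.apply_symm_apply]
    exact pow_ne_zero _ (by norm_num)
  -- Along the line `z₀ + s u` each coordinate, and the inner product with `u`, vanishes for at most
  -- one `s`.
  obtain ⟨s, hs⟩ := Set.Countable.exists_real_notMem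
    ((Set.countable_iUnion fun i =>
      countable_add_mul_eq_zero (d := inner ℂ (b i) u) (Or.inl (hz₀ i))).union
      (countable_add_mul_eq_zero (a := inner ℂ z₀ u) (Or.inr (inner_self_ne_zero (𝕜 := ℂ).2 hu))))
  simp only [Set.mem_union, Set.mem_iUnion, Set.mem_ofPred_eq, not_or, not_exists] at hs
  let z := z₀ + (s : ℂ) • u
  have hz1 : inner ℂ z u ≠ 0 := by
    simpa [z, inner_add_left, inner_smul_left] using hs.2
  have hz2 (i) : inner ℂ (b i) z ≠ 0 := by
    simpa [z, inner_add_right, inner_smul_right] using hs.1 i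
  have hz3 : z ≠ 0 := fun h => hz1 (by rw [h, inner_zero_left])
  refine ⟨(‖z‖⁻¹ : ℂ) • z, by simp [norm_smul, hz3], ?_, fun i => ?_⟩
  · rw [inner_smul_left]
    exact mul_ne_zero (by simpa using hz3) hz1
  · rw [inner_smul_right]
    exact mul_ne_zero (by simpa using hz3) (hz2 i)

variable [CompleteSpace V]

/-- Some unitary perturbation of rank one of the identity maps a given nonzero vector to a vector
with nonzero coordinates in a given countable Hilbert basis. -/
theorem HilbertBasis.exists_unitary_coord_ne_zero [Countable ι] (b : HilbertBasis ι ℂ V) {u : V}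
    (hu : u ≠ 0) : ∃ (R : unitary (V →L[ℂ] V)) (z : V) (a : ℂ),
      (∀ v, R.1 v = v + (a * inner ℂ z v) • z) ∧ ∀ i, inner ℂ (b i) (R.1 u) ≠ 0 := by
  obtain ⟨z, hz, hzu, hbz⟩ := b.exists_coord_ne_zero hu
  let β (i) := inner ℂ z u * inner ℂ (b i) z
  have hβ (i) : β i ≠ 0 := mul_ne_zero hzu (hbz i)
  -- For `R = 1 + (exp(it) - 1) P`, with `P` the projection onto the line of `z`, coordinate `i` of
  -- `R u` is `⟨b i, u⟩ + (exp(it) - 1) β i`. It vanishes only if `exp(it) = 1 - ⟨b i, u⟩ / β i`.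
  obtain ⟨t, ht⟩ := Set.Countable.exists_real_notMem (Set.countable_iUnion fun i : ι =>
    countable_circleExp_mul_eq one_ne_zero (1 - inner ℂ (b i) u / β i))
  simp only [Set.mem_iUnion, Set.mem_ofPred_eq, not_exists, mul_one] at ht
  have hR (v : V) : (1 + ((Circle.exp t : ℂ) - 1) • (Submodule.span ℂ {z}).starProjection
      : V →L[ℂ] V) v = v + (((Circle.exp t : ℂ) - 1) * inner ℂ z v) • z := by
    rw [add_apply, smul_apply, Submodule.starProjection_unit_singleton ℂ hz, smul_smul]
    rfl
  refine ⟨⟨1 + ((Circle.exp t : ℂ) - 1) • (Submodule.span ℂ {z}).starProjection,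
    isStarProjection_starProjection.one_add_smul_mem_unitary _⟩, z, (Circle.exp t : ℂ) - 1, hR,
    fun i h => ht i ?_⟩
  change inner ℂ (b i) ((1 + ((Circle.exp t : ℂ) - 1) • (Submodule.span ℂ {z}).starProjection
      : V →L[ℂ] V) u) = 0 at h
  rw [hR, inner_add_right, inner_smul_right] at h
  have h1 : inner ℂ (b i) u = (1 - (Circle.exp t : ℂ)) * β i := by
    simp only [β]
    linear_combination h
  rw [h1, mul_div_cancel_right₀ _ (hβ i)]
  ring

end CyclicPerturbation

section Irreducible

variable {V : Type u} [NormedAddCommGroup V] [InnerProductSpace ℂ V] [CompleteSpace V]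
  {ι : Type w}

theorem Submodule.starProjection_apply_comm {W : Submodule ℂ V} [W.HasOrthogonalProjection]
    {T : V →L[ℂ] V} (h : ∀ w ∈ W, T w ∈ W) (h' : ∀ w ∈ W, (star T) w ∈ W) (v : V) :
    W.starProjection (T v) = T (W.starProjection v) := by
  refine Submodule.eq_starProjection_of_mem_orthogonal (h _ (W.starProjection_apply_mem v)) ?_
  intro w hw
  rw [← map_sub, ← ContinuousLinearMap.adjoint_inner_left]
  exact W.sub_starProjection_mem_orthogonal v _ (h' w hw)

/-- A diagonal unitary operator with distinct eigenvalues and an operator which maps one of the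
basis vectors to a vector with nonzero coordinates have no common reducing subspaces. -/
theorem eq_bot_or_eq_top_of_invariant (b : HilbertBasis ι ℂ V) {c : ι → Circle}
    (hc : Function.Injective c) {U : unitary (V →L[ℂ] V)} (hU : ∀ i, U.1 (b i) = (c i : ℂ) • b i)
    {T : V →L[ℂ] V} {i₀ : ι} (hT : ∀ i, inner ℂ (b i) (T (b i₀)) ≠ 0) {W : Submodule ℂ V}
    (hW : IsClosed (W : Set V)) (hWU : ∀ w ∈ W, U.1 w ∈ W) (hWU' : ∀ w ∈ W, (star U.1) w ∈ W)
    (hWT : ∀ w ∈ W, T w ∈ W) (hWT' : ∀ w ∈ W, (star T) w ∈ W) : W = ⊥ ∨ W = ⊤ := by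
  have : CompleteSpace W := hW.completeSpace_coe
  have hPU := Submodule.starProjection_apply_comm hWU hWU'
  have hPT := Submodule.starProjection_apply_comm hWT hWT'
  have hcc (i) : (c i : ℂ) * starRingEnd ℂ (c i) = 1 := by
    rw [← Circle.coe_inv_eq_conj, ← Circle.coe_mul, mul_inv_cancel, Circle.coe_one]
  have hin (j) (v : V) : inner ℂ (b j) (U.1 v) = c j * inner ℂ (b j) v := by
    rw [← Unitary.inner_map_map U (b j) v, hU, inner_smul_left, ← mul_assoc, hcc, one_mul]
  -- The projection onto `W` commutes with `U`, whose eigenvalues are distinct, so it is diagonal in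
  -- `b`.
  have hoff {i j} (hij : j ≠ i) : inner ℂ (b j) (W.starProjection (b i)) = 0 := by
    have h1 := hin j (W.starProjection (b i))
    rw [← hPU, hU, map_smul, inner_smul_right] at h1
    have h2 : ((c i : ℂ) - c j) * inner ℂ (b j) (W.starProjection (b i)) = 0 := by
      linear_combination h1
    refine (mul_eq_zero.1 h2).resolve_left fun h3 => hij (hc ?_).symm
    exact Circle.ext (sub_eq_zero.1 h3)
  have hP (i) : W.starProjection (b i) = inner ℂ (b i) (W.starProjection (b i)) • b i := by
    refine b.ext_inner fun j => ?_
    rw [inner_smul_right]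
    by_cases hij : j = i
    · subst hij
      rw [inner_self_eq_norm_sq_to_K, b.orthonormal.1]; simp
    · rw [hoff hij, b.orthonormal.2 hij, mul_zero]
  let d (i) := inner ℂ (b i) (W.starProjection (b i))
  -- Comparing coordinate `j` of `P T (b i₀) = T P (b i₀)` for the projection `P` shows that `P` is
  -- a scalar, because that coordinate of `T (b i₀)` is nonzero.
  have hd (j) : starRingEnd ℂ (d j) = d i₀ := by
    have h1 : inner ℂ (b j) (W.starProjection (T (b i₀))) = d i₀ * inner ℂ (b j) (T (b i₀)) := by
      rw [hPT, hP, map_smul, inner_smul_right]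
    rw [← Submodule.inner_starProjection_left_eq_right, hP j, inner_smul_left] at h1
    exact mul_right_cancel₀ (hT j) h1
  by_cases h0 : d i₀ = 0
  · left
    rw [Submodule.eq_bot_iff]
    intro v hv
    refine b.eq_zero_of_inner fun j => ?_
    have hdj : d j = 0 := by
      have := hd j
      rwa [h0, map_eq_zero] at this
    rw [← Submodule.starProjection_eq_self_iff.2 hv,
      ← Submodule.inner_starProjection_left_eq_right, hP j]
    change inner ℂ (d j • b j) v = 0
    rw [hdj, zero_smul, inner_zero_left]
  · right
    rw [Submodule.eq_top_iff']
    intro v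
    have hdj (j) : d j ≠ 0 := fun h => h0 (by rw [← hd j, h, map_zero])
    have hbW (j) : b j ∈ W := by
      have h1 := W.starProjection_apply_mem (b j)
      rw [hP j] at h1
      exact (W.smul_mem_iff (hdj j)).1 h1
    rw [← Submodule.starProjection_eq_self_iff, eq_comm, ← sub_eq_zero]
    exact b.eq_zero_of_inner fun j => W.sub_starProjection_mem_orthogonal v _ (hbW j)

end Irreducible

/-! ### Weak containment from asymptotic intertwiners -/

section Asymptotic

open Filter Topology

variable {H : Type u} [Group H] {X : Type v} (B : FreeGroupBasis X H) {σ ρ : UnitaryRep H}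
  {J : ℕ → σ.space →ₗᵢ[ℂ] ρ.space}

include B in
theorem tendsto_toHom_sub (hJ : ∀ x ξ, Tendsto
      (fun k => (ρ.toHom (B x)).1 (J k ξ) - J k ((σ.toHom (B x)).1 ξ)) atTop (𝓝 0))
    (h : H) (ξ : σ.space) :
    Tendsto (fun k => (ρ.toHom h).1 (J k ξ) - J k ((σ.toHom h).1 ξ)) atTop (𝓝 0) := by
  induction h using B.induction generalizing ξ with
  | one => simp
  | basis x => exact hJ x ξ
  | inv x =>
    -- The estimate for `x` at `σ(x)⁻¹ ξ`, carried back by the isometry `ρ(x)⁻¹`, is the estimate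
    -- for `x⁻¹` at `ξ`.
    have h1 := hJ x ((σ.toHom (B x)⁻¹).1 ξ)
    rw [tendsto_zero_iff_norm_tendsto_zero] at h1 ⊢
    refine h1.congr fun k => ?_
    rw [UnitaryRep.toHom_apply_inv, norm_sub_rev,
      ← Unitary.norm_map (ρ.toHom (B x)) (_ - J k ((σ.toHom (B x)⁻¹).1 ξ)), map_sub]
    congr 2
    exact (UnitaryRep.toHom_apply_inv _ _ _).symm
  | mul g h hg hh =>
    have h1 := hh ξ
    have h2 := hg ((σ.toHom h).1 ξ)
    have h3 : Tendsto (fun k => (ρ.toHom g).1 ((ρ.toHom h).1 (J k ξ) - J k ((σ.toHom h).1 ξ)))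
        atTop (𝓝 0) := by
      have := ((ρ.toHom g).1.continuous.tendsto 0).comp h1
      rwa [map_zero] at this
    have h4 := h3.add h2
    rw [add_zero] at h4
    refine h4.congr fun k => ?_
    rw [UnitaryRep.toHom_mul_apply, UnitaryRep.toHom_mul_apply, map_sub]
    abel

include B in
theorem tendsto_lift_sub (hJ : ∀ x ξ, Tendsto
      (fun k => (ρ.toHom (B x)).1 (J k ξ) - J k ((σ.toHom (B x)).1 ξ)) atTop (𝓝 0))
    (f : PreGroupCStar H) (ξ : σ.space) :
    Tendsto (fun k => PreGroupCStar.lift ρ f (J k ξ) - J k (PreGroupCStar.lift σ f ξ)) atTop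
      (𝓝 0) := by
  induction f using PreGroupCStar.induction with
  | zero => simp
  | add f g hf hg =>
    have h := hf.add hg
    rw [add_zero] at h
    refine h.congr fun k => ?_
    simp only [map_add, add_apply]
    abel
  | single h c =>
    have h1 := (tendsto_toHom_sub B hJ h ξ).const_smul c
    rw [smul_zero] at h1
    refine h1.congr fun k => ?_
    rw [PreGroupCStar.lift_single, PreGroupCStar.lift_single, smul_apply, smul_apply, map_smul,
      smul_sub]

include B in
/-- If a representation `σ` of a free group is approximately contained in a representation `ρ`
on the generators, then it is weakly contained in `ρ`. -/
theorem norm_lift_apply_le (hJ : ∀ x ξ, Tendsto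
      (fun k => (ρ.toHom (B x)).1 (J k ξ) - J k ((σ.toHom (B x)).1 ξ)) atTop (𝓝 0))
    (f : PreGroupCStar H) (ξ : σ.space) :
    ‖PreGroupCStar.lift σ f ξ‖ ≤ ‖PreGroupCStar.lift ρ f‖ * ‖ξ‖ := by
  have h1 := (tendsto_zero_iff_norm_tendsto_zero.1 (tendsto_lift_sub B hJ f ξ)).const_add
    (‖PreGroupCStar.lift ρ f‖ * ‖ξ‖)
  rw [add_zero] at h1
  refine ge_of_tendsto' h1 fun k => ?_
  rw [← (J k).norm_map (PreGroupCStar.lift σ f ξ), ← (J k).norm_map ξ]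
  calc _ ≤ ‖PreGroupCStar.lift ρ f (J k ξ)‖ +
        ‖PreGroupCStar.lift ρ f (J k ξ) - J k (PreGroupCStar.lift σ f ξ)‖ := by
        rw [norm_sub_rev]
        exact norm_le_norm_add_norm_sub' _ _
    _ ≤ _ := by
      gcongr
      exact ContinuousLinearMap.le_opNorm _ _

end Asymptotic

/-! ### Construction of the Choi representation -/

section ChoiRepresentation

open Filter Topology

variable {H : Type u} [Group H] {X : Type v}

theorem FreeGroupBasis.countable [Countable X] (B : FreeGroupBasis X H) : Countable H :=
  B.repr.injective.countable

/-- A countable free group has a sequence of finite-dimensional unitary representations that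
determines the maximal C*-seminorm, up to a factor `2`, on a dense sequence. -/
theorem exists_finiteDimensional_seq [Countable X] (B : FreeGroupBasis X H) :
    ∃ (f : ℕ → PreGroupCStar H) (σ : ℕ → UnitaryRep H), DenseRange f ∧
      (∀ n, FiniteDimensional ℂ (σ n).space) ∧
      ∀ n, ∃ ξ : (σ n).space, ‖ξ‖ ≤ 1 ∧ ‖f n‖ ≤ 2 * ‖PreGroupCStar.lift (σ n) (f n) ξ‖ := by
  have := B.countable
  have := PreGroupCStar.separableSpace (H := H)
  choose σ hσ ξ h1 h2 using UnitaryRep.exists_finiteDimensional_norm_le B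
  let f := TopologicalSpace.denseSeq (PreGroupCStar H)
  exact ⟨f, fun n => σ (f n), TopologicalSpace.denseRange_denseSeq _, fun n => hσ _,
    fun n => ⟨ξ (f n), h1 _, h2 _⟩⟩

/-- A lower bound for the norm on a dense sequence passes to the completion by continuity; any fixed
constant in place of `2` would do. -/
theorem GroupCStar.lift_injective_of_norm_le {ρ : UnitaryRep H} {f : ℕ → PreGroupCStar H}
    (hf : DenseRange f) (h : ∀ n, ‖f n‖ ≤ 2 * ‖PreGroupCStar.lift ρ (f n)‖) :
    Function.Injective (GroupCStar.lift ρ) := by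
  have hle (a : GroupCStar H) : ‖a‖ ≤ 2 * ‖GroupCStar.lift ρ a‖ := by
    have hc := GroupCStar.continuous_lift ρ
    refine (GroupCStar.denseRange_ofPre.comp hf GroupCStar.continuous_ofPre).induction_on
      (p := fun a => ‖a‖ ≤ 2 * ‖GroupCStar.lift ρ a‖) a
      (isClosed_le (by fun_prop) (by fun_prop)) fun n => ?_
    simp only [Function.comp, GroupCStar.norm_ofPre, GroupCStar.lift_ofPre]
    exact h n
  rw [injective_iff_map_eq_zero]
  intro a ha
  have := hle a
  rw [ha, norm_zero, mul_zero] at this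
  exact norm_le_zero_iff.1 this

/-- The embedding of a summand into a Hilbert sum. -/
noncomputable def lp.singleLinearIsometry {α : Type w} [DecidableEq α] (E : α → Type u)
    [∀ a, NormedAddCommGroup (E a)] [∀ a, InnerProductSpace ℂ (E a)] (a : α) :
    E a →ₗᵢ[ℂ] lp E 2 where
  toLinearMap := lp.lsingle 2 a
  norm_map' := lp.norm_single (by simp) a

theorem PreGroupCStar.one_le_norm_one : 1 ≤ ‖(1 : PreGroupCStar H)‖ := by
  have h := PreGroupCStar.le_maxNorm ⟨EuclideanSpace ℂ PUnit.{u + 1}, 1⟩ (1 : PreGroupCStar H)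
  rw [map_one] at h
  have h1 : ‖(1 : EuclideanSpace ℂ PUnit.{u + 1} →L[ℂ] EuclideanSpace ℂ PUnit.{u + 1})‖ = 1 :=
    ContinuousLinearMap.norm_id
  exact h1.ge.trans h

section Blocks

variable {S V : Type u} [NormedAddCommGroup S] [InnerProductSpace ℂ S] [NormedAddCommGroup V]
  [InnerProductSpace ℂ V] {κ : Type w} [Fintype κ] (e : OrthonormalBasis κ ℂ S) {U : S →L[ℂ] S}
  {T : V →L[ℂ] V} {μ : κ → Circle}

theorem map_eq_of_eigenvectors (hU : ∀ i, U (e i) = (μ i : ℂ) • e i) {J : S →ₗᵢ[ℂ] V}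
    (hT : ∀ i, T (J (e i)) = (μ i : ℂ) • J (e i)) (ξ : S) : T (J ξ) = J (U ξ) := by
  have h : T.toLinearMap.comp J.toLinearMap = J.toLinearMap.comp U.toLinearMap := by
    refine e.toBasis.ext fun i => ?_
    rw [OrthonormalBasis.coe_toBasis]
    change T (J (e i)) = J (U (e i))
    rw [hU, map_smul, hT]
  exact LinearMap.congr_fun h ξ

theorem tendsto_sub_of_eigenvectors (hU : ∀ i, U (e i) = (μ i : ℂ) • e i) {J : ℕ → S →ₗᵢ[ℂ] V}
    {c : ℕ → κ → ℂ} (hT : ∀ k i, T (J k (e i)) = c k i • J k (e i))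
    (hc : ∀ i, Tendsto (fun k => c k i) atTop (𝓝 (μ i))) (ξ : S) :
    Tendsto (fun k => T (J k ξ) - J k (U ξ)) atTop (𝓝 0) := by
  have hξ : ξ ∈ Submodule.span ℂ (Set.range e) := by
    rw [← OrthonormalBasis.coe_toBasis, e.toBasis.span_eq]; trivial
  induction hξ using Submodule.span_induction with
  | mem ξ hξ =>
    obtain ⟨i, rfl⟩ := hξ
    have h1 := tendsto_iff_norm_sub_tendsto_zero.1 (hc i)
    rw [tendsto_zero_iff_norm_tendsto_zero]
    refine h1.congr fun k => ?_
    rw [hT, hU, map_smul, ← sub_smul, norm_smul, (J k).norm_map, e.norm_eq_one, mul_one]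
  | zero => simp
  | add ξ η _ _ h1 h2 =>
    have h3 := h1.add h2
    rw [add_zero] at h3
    refine h3.congr fun k => ?_
    simp only [map_add]
    abel
  | smul a ξ _ h1 =>
    have h3 := h1.const_smul a
    rw [smul_zero] at h3
    refine h3.congr fun k => ?_
    simp only [map_smul, smul_sub]

end Blocks

/-- Countably many phases become pairwise distinct after a perturbation that tends to zero. -/
theorem exists_injective_circle {ι : Type w} [Countable ι] (m : ι → Circle) :
    ∃ c : ι → Circle, Function.Injective c ∧
      ∀ φ : ℕ → ι, Function.Injective φ → ∀ μ : Circle, (∀ k, m (φ k) = μ) →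
        Tendsto (fun k => (c (φ k) : ℂ)) atTop (𝓝 μ) := by
  obtain ⟨code, hcode⟩ := exists_injective_nat ι
  let δ : ι → ℝ := fun j => 1 / ((code j : ℝ) + 1)
  have hδ {i j} (hij : i ≠ j) : δ i - δ j ≠ 0 := by
    intro h
    have h1 : (1 : ℝ) / ((code i : ℝ) + 1) = 1 / ((code j : ℝ) + 1) := sub_eq_zero.1 h
    rw [one_div, one_div, inv_inj] at h1
    exact hij (hcode (by exact_mod_cast add_right_cancel h1))
  -- The phases `m j * exp(i t δ j)` with `δ j` distinct and tending to zero: a coincidence at `i ≠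
  -- j` means `exp(i t (δ i - δ j)) = m j / m i`, so only countably many `t` are bad.
  obtain ⟨t, ht⟩ := Set.Countable.exists_real_notMem <| Set.countable_iUnion
    fun q : {q : ι × ι // q.1 ≠ q.2} =>
      countable_circleExp_mul_eq (hδ q.2) ((m q.1.2 / m q.1.1 : Circle) : ℂ)
  simp only [Set.mem_iUnion, Set.mem_ofPred_eq, not_exists] at ht
  refine ⟨fun j => m j * Circle.exp (t * δ j), fun i j hij => ?_, fun φ hφ μ hμ => ?_⟩
  · by_contra hne
    refine ht ⟨(i, j), hne⟩ (congrArg _ ?_)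
    have h1 : m i * Circle.exp (t * δ i) = m j * Circle.exp (t * δ j) := hij
    rw [mul_sub, Circle.exp_sub, div_eq_div_iff_mul_eq_mul, mul_comm, h1]
  · have h1 : Tendsto (fun k => δ (φ k)) atTop (𝓝 0) :=
      tendsto_one_div_add_atTop_nhds_zero_nat.comp (hcode.comp hφ).nat_tendsto_atTop
    have hc : Continuous fun s : ℝ => ((μ * Circle.exp (t * s) : Circle) : ℂ) := by fun_prop
    have h2 := (hc.tendsto 0).comp h1
    rw [mul_zero, Circle.exp_zero, mul_one] at h2
    exact h2.congr fun k => by simp only [Function.comp, hμ]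

/-- Bounded vectors in distinct summands tend weakly to zero, since the component norms of `z` are
square-summable. Thus a rank-one perturbation is invisible far out in the sum. -/
theorem lp.tendsto_inner_single {β : Type w} [DecidableEq β] {E : β → Type u}
    [∀ a, NormedAddCommGroup (E a)] [∀ a, InnerProductSpace ℂ (E a)] (z : lp E 2)
    {φ : ℕ → β} (hφ : Function.Injective φ)
    (η : ∀ k, E (φ k)) {C : ℝ} (hη : ∀ k, ‖η k‖ ≤ C) :
    Tendsto (fun k => inner ℂ z (lp.single 2 (φ k) (η k))) atTop (𝓝 0) := by
  have h1 : Summable fun p => ‖z p‖ ^ 2 := by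
    simpa using (lp.hasSum_norm (by simp) z).summable
  have h3 := (h1.comp_injective hφ).tendsto_atTop_zero
  have h4 : Tendsto (fun k => ‖z (φ k)‖) atTop (𝓝 0) := by
    have := (Real.continuous_sqrt.tendsto 0).comp h3
    rw [Real.sqrt_zero] at this
    exact this.congr fun k => Real.sqrt_sq (norm_nonneg _)
  have h5 := h4.mul_const C
  rw [zero_mul] at h5
  refine squeeze_zero_norm (fun k => ?_) h5
  rw [lp.inner_single_right]
  exact (norm_inner_le_norm _ _).trans (mul_le_mul_of_nonneg_left (hη k) (norm_nonneg _))

/-- At least two generators are needed: one operator separates the coordinates and the other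
connects them. Separability of the space is recorded because it makes point spectra countable. -/
theorem exists_choi_representation [Countable X] (B : FreeGroupBasis X H) {x₀ x₁ : X}
    (hne : x₁ ≠ x₀) :
    ∃ π : FaithfulIrrep (GroupCStar H), TopologicalSpace.SeparableSpace π.space ∧
      ∀ x, x ≠ x₀ → IsDiagonalizableOp (π.toHom (GroupCStar.of (B x))) := by
  classical
  obtain ⟨f, σ, hf, hσ, hfσ⟩ := exists_finiteDimensional_seq B
  choose e μ he using fun n x => exists_orthonormalBasis_eigenvectors ((σ n).toHom (B x))
  -- The second index counts copies of `σ n`; infinitely many are needed for the perturbations to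
  -- fade as `k → ∞`.
  let E : ℕ × ℕ → Type u := fun p => (σ p.1).space
  let V := lp E 2
  let J : ∀ n : ℕ, ℕ → (σ n).space →ₗᵢ[ℂ] V := fun n k => lp.singleLinearIsometry E (n, k)
  let ι := Σ p : ℕ × ℕ, Fin (Module.finrank ℂ (E p))
  let b : X → HilbertBasis ι ℂ V := fun x => lp.hilbertBasis fun p => e p.1 x
  have hb (x n k i) : b x ⟨(n, k), i⟩ = J n k (e n x i) := lp.hilbertBasis_apply _ _
  let m : X → ι → Circle := fun x j => μ j.1.1 x j.2
  obtain ⟨c, hc, hcm⟩ := exists_injective_circle (m x₁)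
  let D : X → unitary (V →L[ℂ] V) := fun x => (b x).diagonal (m x)
  have hD (x n k ξ) : (D x).1 (J n k ξ) = J n k (((σ n).toHom (B x)).1 ξ) := by
    refine map_eq_of_eigenvectors (e n x) (he n x) (fun i => ?_) ξ
    rw [← hb]
    exact (b x).diagonal_apply _ _
  let D₁ : unitary (V →L[ℂ] V) := (b x₁).diagonal c
  have hD₁ (n ξ) : Tendsto (fun k => D₁.1 (J n k ξ) - J n k (((σ n).toHom (B x₁)).1 ξ)) atTop
      (𝓝 0) := by
    refine tendsto_sub_of_eigenvectors (e n x₁) (he n x₁) (c := fun k i => c ⟨(n, k), i⟩)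
      (fun k i => ?_) (fun i => ?_) ξ
    · rw [← hb]
      exact (b x₁).diagonal_apply _ _
    · refine hcm (fun k => ⟨(n, k), i⟩) (fun k l h => ?_) _ fun k => rfl
      exact congrArg (fun j : ι => j.1.2) h
  -- If all the `σ n` were zero-dimensional, the norm would vanish on a dense set, contrary to `1 ≤
  -- ‖1‖`.
  have hι : Nonempty ι := by
    by_contra hempty
    rw [not_nonempty_iff] at hempty
    have hV (n) (ξ : (σ n).space) : ξ = 0 := by
      apply (J n 0).injective
      rw [map_zero]
      exact (b x₁).eq_zero_of_inner fun i => hempty.elim i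
    have hz (g : PreGroupCStar H) : ‖g‖ = 0 := by
      refine hf.induction_on (p := fun g => ‖g‖ = 0) g
        (isClosed_eq continuous_norm continuous_const) fun n => ?_
      obtain ⟨ξ, -, h1⟩ := hfσ n
      rw [hV n (PreGroupCStar.lift (σ n) (f n) ξ), norm_zero, mul_zero] at h1
      exact le_antisymm h1 (norm_nonneg _)
    have h1 := PreGroupCStar.one_le_norm_one (H := H)
    rw [hz] at h1
    exact absurd h1 (by norm_num)
  obtain ⟨i₀⟩ := hι
  have hu : (D x₀).1 (b x₁ i₀) ≠ 0 := by
    rw [← norm_ne_zero_iff, Unitary.norm_map, (b x₁).orthonormal.1]; exact one_ne_zero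
  obtain ⟨R, z, a, hR, hRu⟩ := (b x₁).exists_unitary_coord_ne_zero hu
  have hz (n : ℕ) (η : (σ n).space) : Tendsto (fun k => inner ℂ z (J n k η)) atTop (𝓝 0) := by
    exact lp.tendsto_inner_single (E := E) z (φ := fun k => (n, k))
      (fun k l h => (Prod.ext_iff.1 h).2) (fun _ => η) (C := ‖η‖) fun _ => le_rfl
  let Y : X → unitary (V →L[ℂ] V) := fun x => if x = x₀ then R * D x₀ else
    if x = x₁ then D₁ else D x
  have hY₀ : Y x₀ = R * D x₀ := if_pos rfl
  have hY₁ : Y x₁ = D₁ := (if_neg hne).trans (if_pos rfl)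
  have hY {x} (h₀ : x ≠ x₀) (h₁ : x ≠ x₁) : Y x = D x :=
    (if_neg h₀).trans (if_neg h₁)
  let ρ : UnitaryRep H := UnitaryRep.ofBasis B Y
  have hρ (x) : ρ.toHom (B x) = Y x := UnitaryRep.ofBasis_toHom B Y x
  have hJ (n x ξ) : Tendsto (fun k => (ρ.toHom (B x)).1 (J n k ξ) -
      J n k (((σ n).toHom (B x)).1 ξ)) atTop (𝓝 0) := by
    rw [hρ]
    by_cases h₀ : x = x₀
    · subst h₀
      -- The error is exactly the rank-one term of `R`, evaluated at vectors tending weakly to zero.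
      have h1 := ((hz n (((σ n).toHom (B x)).1 ξ)).const_mul a).smul_const z
      rw [mul_zero, zero_smul] at h1
      refine h1.congr fun k => ?_
      have h2 : (Y x).1 (J n k ξ) = R.1 ((D x).1 (J n k ξ)) := by rw [hY₀]; rfl
      rw [h2, hD, hR, add_sub_cancel_left]
    by_cases h₁ : x = x₁
    · subst h₁
      rw [hY₁]
      exact hD₁ n ξ
    · rw [hY h₀ h₁]
      simp [hD]
  have hinj : Function.Injective (GroupCStar.lift ρ) := by
    refine GroupCStar.lift_injective_of_norm_le hf fun n => ?_
    obtain ⟨ξ, h1, h2⟩ := hfσ n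
    refine h2.trans ?_
    have h3 := norm_lift_apply_le B (hJ n) (f n) ξ
    have h4 := mul_le_of_le_one_right (norm_nonneg (PreGroupCStar.lift ρ (f n))) h1
    linarith
  have hlift (x) : GroupCStar.lift ρ (GroupCStar.of (B x)) = (Y x).1 := by
    rw [GroupCStar.lift_of, hρ]
  refine ⟨
    { space := V
      toHom := GroupCStar.lift ρ
      faithful := hinj
      nontrivial := ⟨_, _, hu⟩
      irreducible := fun W hW hinv => ?_ }, ?_, fun x hx => ?_⟩
  -- Invariance under the *-algebra includes invariance under adjoints, so `W` reduces both
  -- perturbed operators.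
  · have h1 (x w) (hw : w ∈ W) : (Y x).1 w ∈ W := by
      rw [← hlift]; exact hinv _ w hw
    have h2 (x w) (hw : w ∈ W) : (star (Y x).1) w ∈ W := by
      rw [← hlift, ← map_star]; exact hinv _ w hw
    refine eq_bot_or_eq_top_of_invariant (b x₁) hc (U := Y x₁) (T := (Y x₀).1) (i₀ := i₀)
      (fun i => ?_) (fun i => ?_) hW (h1 x₁) (h2 x₁) (h1 x₀) (h2 x₀)
    · rw [hY₁]; exact (b x₁).diagonal_apply _ _
    · rw [hY₀]; exact hRu i
  · have (p : ℕ × ℕ) : TopologicalSpace.SeparableSpace (E p) :=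
      have : FiniteDimensional ℂ (E p) := hσ p.1
      have : ProperSpace (E p) := FiniteDimensional.proper ℂ _
      inferInstance
    exact lp.separableSpace
  · change IsDiagonalizableOp (GroupCStar.lift ρ (GroupCStar.of (B x)))
    rw [hlift]
    by_cases h₁ : x = x₁
    · rw [h₁, hY₁]
      exact (b x₁).isDiagonalizableOp ((b x₁).diagonal_apply _)
    · rw [hY hx h₁]
      exact (b x).isDiagonalizableOp ((b x).diagonal_apply _)

end ChoiRepresentation

/-! ### Generic characters of a free group -/

section GenericCharacter

variable {H : Type u} [Group H] {X : Type v} (B : FreeGroupBasis X H)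

theorem FreeGroupBasis.lift_basis {M : Type w} [Group M] (φ : X → M) (x : X) :
    B.lift φ (B x) = φ x :=
  congr_fun (B.lift.symm_apply_apply φ) x

open Classical in
/-- The exponent sum of the basis element `x`. -/
noncomputable def FreeGroupBasis.exponentSum (x : X) : H →* Multiplicative ℤ :=
  B.lift fun y => .ofAdd (if y = x then 1 else 0)

-- A value on the circle has countably many real logarithms `s`, and the nonconstant polynomial `P`
-- takes each value `s` finitely often.
open Polynomial in
theorem countable_circleExp_eval_eq {P : ℝ[X]} {n : ℕ} (hn : n ≠ 0) (hP : P.coeff n ≠ 0) (κ : ℂ) :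
    {t : ℝ | (Circle.exp (P.eval t) : ℂ) = κ}.Countable := by
  have h1 := (countable_circleExp_mul_eq one_ne_zero κ).biUnion
    (t := fun s _ => {t : ℝ | P.eval t = s}) fun s _ => by
      have h2 : P - C s ≠ 0 := fun h => hP <| by
        have h3 := congrArg (fun Q : ℝ[X] => Q.coeff n) h
        simpa [coeff_C, hn] using h3
      refine ((P - C s).finite_setOfPred_isRoot h2).countable.mono fun t ht => ?_
      have ht' : P.eval t = s := ht
      simp [IsRoot, ht']
  refine h1.mono fun t ht => Set.mem_biUnion (x := P.eval t) ?_ rfl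
  change (Circle.exp (P.eval t * 1) : ℂ) = κ
  rw [mul_one]
  exact ht

open Polynomial in
/-- A countable free group has characters which avoid a given countable set on all elements with a
nonzero exponent sum. -/
theorem exists_generic_character [Countable X] {D : Set ℂ} (hD : D.Countable) :
    ∃ χ : H →* Circle, ∀ h x, B.exponentSum x h ≠ 1 → (χ h : ℂ) ∉ D := by
  classical
  have := B.countable
  have := hD.to_subtype
  obtain ⟨code, hcode⟩ := exists_injective_nat X
  -- Distinct monomials in one real parameter `t` stand for the phases, so that `χ(x) = exp(i
  -- t^(code x + 1))`. The exponent sums of `h` are the coefficients of `P h`; the shift by one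
  -- keeps the constant term zero, so a nonzero exponent sum makes `P h` nonconstant.
  let P : H →* Multiplicative ℝ[X] := B.lift fun x => .ofAdd (Polynomial.X ^ (code x + 1))
  have hP (x h) : (P h).toAdd.coeff (code x + 1) = ((B.exponentSum x h).toAdd : ℝ) := by
    have h1 : (AddMonoidHom.toMultiplicative (lcoeff ℝ (code x + 1)).toAddMonoidHom).comp P =
        (AddMonoidHom.toMultiplicative (Int.castAddHom ℝ)).comp (B.exponentSum x) := by
      refine B.ext_hom _ _ fun y => ?_
      apply Multiplicative.toAdd.injective
      simp only [P, FreeGroupBasis.exponentSum, MonoidHom.comp_apply, B.lift_basis]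
      change (Polynomial.X ^ (code y + 1) : ℝ[X]).coeff (code x + 1) =
        ((if y = x then 1 else 0 : ℤ) : ℝ)
      rw [coeff_X_pow]
      by_cases hxy : y = x
      · simp [hxy]
      · rw [if_neg hxy, if_neg fun h => hxy (hcode (Nat.succ_injective h)).symm, Int.cast_zero]
    exact congrArg Multiplicative.toAdd (DFunLike.congr_fun h1 h)
  obtain ⟨t, ht⟩ := Set.Countable.exists_real_notMem <| Set.countable_iUnion
    fun q : {q : H × X // B.exponentSum q.2 q.1 ≠ 1} => Set.countable_iUnion fun d : D =>
      countable_circleExp_eval_eq (P := (P q.1.1).toAdd) (Nat.succ_ne_zero (code q.1.2))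
        (by
          rw [hP]
          exact fun h => q.2 (Multiplicative.toAdd.injective (Int.cast_eq_zero.1 h))) d
  simp only [Set.mem_iUnion, Set.mem_ofPred_eq, not_exists] at ht
  let χ : H →* Circle :=
    { toFun h := Circle.exp ((P h).toAdd.eval t)
      map_one' := by simp
      map_mul' g h := by simp [Circle.exp_add] }
  exact ⟨χ, fun h x hx hmem => ht ⟨(h, x), hx⟩ ⟨_, hmem⟩ rfl⟩

end GenericCharacter

/-! ### Conjugation on the abelianized cartesian subgroup -/

section ConjugationOfCommutators

open Monoid.Coprod

variable {G₁ : Type u} {G₂ : Type v} [Group G₁] [Group G₂]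

/-- The commutator `[a, b]` of arbitrary `a ∈ G₁` and `b ∈ G₂`, as an element of the cartesian
subgroup. -/
def commElem (a : G₁) (b : G₂) : cartesianSubgroup G₁ G₂ :=
  ⟨inl a * inr b * (inl a)⁻¹ * (inr b)⁻¹, by simp [MonoidHom.mem_ker]⟩

theorem conjNormal_commGen (k : G₁ × G₂) (x : {a : G₁ // a ≠ 1} × {b : G₂ // b ≠ 1}) :
    MulAut.conjNormal (inl k.1 * inr k.2 : Monoid.Coprod G₁ G₂) (commGen x) =
      commElem k.1 k.2 * (commElem (k.1 * x.1.1) k.2)⁻¹ * commElem (k.1 * x.1.1) (k.2 * x.2.1) *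
        (commElem k.1 (k.2 * x.2.1))⁻¹ := by
  apply Subtype.ext
  rw [MulAut.conjNormal_apply]
  simp only [commElem, commGen, Subgroup.coe_mul, Subgroup.coe_inv, map_mul]
  group

/-- Two lifts of the same `k` differ by an element of `H`, whose conjugation is invisible in a
commutative group. Any lift may therefore be replaced by `inl k.1 * inr k.2`. -/
theorem map_conjNormal_eq {M : Type w} [CommGroup M] (φ : cartesianSubgroup G₁ G₂ →* M)
    {g g' : Monoid.Coprod G₁ G₂} (hg : toProd g = toProd g') (h : cartesianSubgroup G₁ G₂) :
    φ (MulAut.conjNormal g h) = φ (MulAut.conjNormal g' h) := by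
  let u : cartesianSubgroup G₁ G₂ := ⟨g * g'⁻¹, by simp [MonoidHom.mem_ker, hg]⟩
  have h1 : MulAut.conjNormal g h = u * MulAut.conjNormal g' h * u⁻¹ := by
    apply Subtype.ext
    simp only [u, MulAut.conjNormal_apply, Subgroup.coe_mul, Subgroup.coe_inv]
    group
  rw [h1, map_mul, map_mul, map_inv, mul_comm, inv_mul_cancel_left]

open Classical in
theorem exponentSum_commGen (x y : {a : G₁ // a ≠ 1} × {b : G₂ // b ≠ 1}) :
    ((cartesianSubgroupBasis G₁ G₂).exponentSum y (commGen x)).toAdd = if x = y then 1 else 0 := by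
  rw [← cartesianSubgroupBasis_apply, FreeGroupBasis.exponentSum, FreeGroupBasis.lift_basis,
    toAdd_ofAdd]
  by_cases h : x = y
  · rw [if_pos h, if_pos h]
  · rw [if_neg h, if_neg h]

open Classical in
theorem exponentSum_commElem (x : {a : G₁ // a ≠ 1} × {b : G₂ // b ≠ 1}) (a : G₁) (b : G₂) :
    ((cartesianSubgroupBasis G₁ G₂).exponentSum x (commElem a b)).toAdd =
      if a = x.1.1 ∧ b = x.2.1 then 1 else 0 := by
  by_cases h : a ≠ 1 ∧ b ≠ 1
  · refine (exponentSum_commGen (⟨a, h.1⟩, ⟨b, h.2⟩) x).trans (if_congr ?_ rfl rfl)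
    rw [Prod.ext_iff, Subtype.ext_iff, Subtype.ext_iff]
  · have h1 : commElem a b = 1 := by
      apply Subtype.ext
      rw [not_and_or, not_ne_iff, not_ne_iff] at h
      rcases h with rfl | rfl <;> simp [commElem]
    rw [h1, map_one, toAdd_one, if_neg]
    rintro ⟨rfl, rfl⟩
    exact h ⟨x.1.2, x.2.2⟩

open Classical in
theorem exponentSum_conjNormal_commGen (k : G₁ × G₂) {g : Monoid.Coprod G₁ G₂}
    (hg : toProd g = k) (x y : {a : G₁ // a ≠ 1} × {b : G₂ // b ≠ 1}) :
    ((cartesianSubgroupBasis G₁ G₂).exponentSum y (MulAut.conjNormal g (commGen x))).toAdd =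
      (if k.1 = y.1.1 ∧ k.2 = y.2.1 then 1 else 0) -
      (if k.1 * x.1.1 = y.1.1 ∧ k.2 = y.2.1 then 1 else 0) +
      (if k.1 * x.1.1 = y.1.1 ∧ k.2 * x.2.1 = y.2.1 then 1 else 0) -
      (if k.1 = y.1.1 ∧ k.2 * x.2.1 = y.2.1 then 1 else 0) := by
  have hg' : toProd g = toProd (inl k.1 * inr k.2 : Monoid.Coprod G₁ G₂) := by
    rw [hg, map_mul, toProd_apply_inl, toProd_apply_inr]; simp
  rw [map_conjNormal_eq _ hg', conjNormal_commGen]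
  simp only [map_mul, map_inv, toAdd_mul, toAdd_inv, exponentSum_commElem]
  ring

theorem exists_notMem_pair_of_two_lt_card {G : Type u} (h : 2 < ENat.card G) (a b : G) :
    ∃ c, c ≠ a ∧ c ≠ b := by
  by_contra! hcon
  have h1 : (Set.univ : Set G) ⊆ {a, b} := fun c _ => by
    by_cases hc : c = a
    · exact Or.inl hc
    · exact Or.inr (hcon c hc)
  have h2 := Set.encard_le_encard h1
  rw [Set.encard_univ] at h2
  have h3 := h2.trans (Set.encard_insert_le {b} a)
  rw [Set.encard_singleton, one_add_one_eq_two] at h3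
  exact absurd h3 (not_le.2 h)

/-- Conjugation by a pair of involutions `(k₁, k₂)` fixes the class of `[k₁, k₂]`, since the other
three terms are trivial; this generator has to be avoided as well as `x₀`. -/
theorem exists_commutator_ne (hcard : 2 < ENat.card G₁ ∨ 2 < ENat.card G₂)
    (x₀ : {a : G₁ // a ≠ 1} × {b : G₂ // b ≠ 1}) {k₁ : G₁} {k₂ : G₂} (h₁ : k₁ ≠ 1)
    (h₂ : k₂ ≠ 1) : ∃ x : {a : G₁ // a ≠ 1} × {b : G₂ // b ≠ 1}, x ≠ x₀ ∧
      (x.1.1 = k₁ → x.2.1 = k₂ → k₁ * k₁ ≠ 1 ∨ k₂ * k₂ ≠ 1) := by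
  by_contra! hcon
  have key (a : G₁) (b : G₂) (ha : a ≠ 1) (hb : b ≠ 1) (hne : a ≠ k₁ ∨ b ≠ k₂) :
      ((⟨a, ha⟩, ⟨b, hb⟩) : {a : G₁ // a ≠ 1} × {b : G₂ // b ≠ 1}) = x₀ := by
    by_contra h
    obtain ⟨h3, h4, -⟩ := hcon _ h
    exact hne.elim (· h3) (· h4)
  rcases hcard with h | h
  -- A third element `a` yields a fourth, `a * k₁`, when `k₁` is an involution. The generators `(a,
  -- k₂)` and `(a * k₁, k₂)` would both have to be `x₀`.
  · obtain ⟨a, ha, ha'⟩ := exists_notMem_pair_of_two_lt_card h 1 k₁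
    have e1 := key a k₂ ha h₂ (Or.inl ha')
    obtain ⟨-, -, hk, -⟩ := hcon (⟨k₁, h₁⟩, ⟨k₂, h₂⟩) fun h => ha' <| by
      rw [← h] at e1
      exact congrArg (fun x => x.1.1) e1
    have e2 := key (a * k₁) k₂
      (fun h => ha' (mul_right_cancel (h.trans hk.symm))) h₂ (Or.inl fun h => ha (by simpa using h))
    rw [← e1] at e2
    exact h₁ (mul_eq_left.1 (congrArg (fun x => x.1.1) e2))
  · obtain ⟨b, hb, hb'⟩ := exists_notMem_pair_of_two_lt_card h 1 k₂
    have e1 := key k₁ b h₁ hb (Or.inr hb')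
    obtain ⟨-, -, -, hk⟩ := hcon (⟨k₁, h₁⟩, ⟨k₂, h₂⟩) fun h => hb' <| by
      rw [← h] at e1
      exact congrArg (fun x => x.2.1) e1
    have e2 := key k₁ (b * k₂) h₁
      (fun h => hb' (mul_right_cancel (h.trans hk.symm))) (Or.inr fun h => hb (by simpa using h))
    rw [← e1] at e2
    exact h₂ (mul_eq_left.1 (congrArg (fun x => x.2.1) e2))

/-- A nontrivial element of `G₁ × G₂` moves some commutator, other than a given one, in the
abelianization of the cartesian subgroup. -/
theorem exists_exponentSum_conjNormal_ne [Nontrivial G₁] [Nontrivial G₂]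
    (hcard : 2 < ENat.card G₁ ∨ 2 < ENat.card G₂)
    (x₀ : {a : G₁ // a ≠ 1} × {b : G₂ // b ≠ 1}) {k : G₁ × G₂} (hk : k ≠ 1)
    {g : Monoid.Coprod G₁ G₂} (hg : toProd g = k) :
    ∃ x, x ≠ x₀ ∧ ∃ y, (cartesianSubgroupBasis G₁ G₂).exponentSum y
      (MulAut.conjNormal g (commGen x)) ≠
        (cartesianSubgroupBasis G₁ G₂).exponentSum y (commGen x) := by
  classical
  have hcomm (x y : {a : G₁ // a ≠ 1} × {b : G₂ // b ≠ 1}) :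
      ((cartesianSubgroupBasis G₁ G₂).exponentSum y (commGen x)).toAdd =
        if x.1.1 = y.1.1 ∧ x.2.1 = y.2.1 then 1 else 0 := exponentSum_commElem y x.1.1 x.2.1
  suffices hs : ∃ x, x ≠ x₀ ∧ ∃ y, ((cartesianSubgroupBasis G₁ G₂).exponentSum y
      (MulAut.conjNormal g (commGen x))).toAdd ≠
        ((cartesianSubgroupBasis G₁ G₂).exponentSum y (commGen x)).toAdd by
    obtain ⟨x, hx, y, hxy⟩ := hs
    exact ⟨x, hx, y, fun h => hxy (congrArg _ h)⟩
  obtain ⟨k₁, k₂⟩ := k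
  obtain ⟨a₀, ha₀⟩ := exists_ne (1 : G₁)
  obtain ⟨b₀, hb₀⟩ := exists_ne (1 : G₂)
  by_cases h₁ : k₁ = 1
  · have h₂ : k₂ ≠ 1 := fun h => hk (by rw [h₁, h]; rfl)
    obtain ⟨x, hx, -⟩ := exists_commutator_ne hcard x₀ ha₀ hb₀
    -- At this `y` only the second term survives, so the conjugate has exponent `-1`, while a
    -- generator has exponent `0` or `1`. Other negative witnesses below work alike.
    refine ⟨x, hx, (x.1, ⟨k₂, h₂⟩), ?_⟩
    rw [exponentSum_conjNormal_commGen _ hg, hcomm, if_neg fun h => x.1.2 (h.1.symm.trans h₁),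
      if_pos ⟨by rw [h₁, one_mul], rfl⟩, if_neg fun h => x.2.2 (mul_eq_left.1 h.2),
      if_neg fun h => x.1.2 (h.1.symm.trans h₁)]
    split_ifs <;> norm_num
  by_cases h₂ : k₂ = 1
  · obtain ⟨x, hx, -⟩ := exists_commutator_ne hcard x₀ ha₀ hb₀
    refine ⟨x, hx, (⟨k₁, h₁⟩, x.2), ?_⟩
    rw [exponentSum_conjNormal_commGen _ hg, hcomm, if_neg fun h => x.2.2 (h.2.symm.trans h₂),
      if_neg fun h => x.1.2 (mul_eq_left.1 h.1), if_neg fun h => x.1.2 (mul_eq_left.1 h.1),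
      if_pos ⟨rfl, by rw [h₂, one_mul]⟩]
    split_ifs <;> norm_num
  obtain ⟨x, hx, hxk⟩ := exists_commutator_ne hcard x₀ h₁ h₂
  by_cases hxk' : x.1.1 = k₁ ∧ x.2.1 = k₂
  · rcases hxk hxk'.1 hxk'.2 with h | h
    · refine ⟨x, hx, (⟨k₁ * k₁, h⟩, ⟨k₂, h₂⟩), ?_⟩
      rw [exponentSum_conjNormal_commGen _ hg, hcomm, if_neg fun h => h₁ (left_eq_mul.1 h.1),
        if_pos ⟨by rw [hxk'.1], rfl⟩, if_neg fun h => x.2.2 (mul_eq_left.1 h.2),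
        if_neg fun h => h₁ (left_eq_mul.1 h.1)]
      split_ifs <;> norm_num
    · refine ⟨x, hx, (⟨k₁, h₁⟩, ⟨k₂ * k₂, h⟩), ?_⟩
      rw [exponentSum_conjNormal_commGen _ hg, hcomm, if_neg fun h => h₂ (left_eq_mul.1 h.2),
        if_neg fun h => x.1.2 (mul_eq_left.1 h.1), if_neg fun h => x.1.2 (mul_eq_left.1 h.1),
        if_pos ⟨rfl, by rw [hxk'.2]⟩]
      split_ifs <;> norm_num
  -- Here `x` differs from `(k₁, k₂)`, so the exponent at `(k₁, k₂)` changes from `0` to `1`.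
  · refine ⟨x, hx, (⟨k₁, h₁⟩, ⟨k₂, h₂⟩), ?_⟩
    rw [exponentSum_conjNormal_commGen _ hg, hcomm, if_pos ⟨rfl, rfl⟩,
      if_neg fun h => x.1.2 (mul_eq_left.1 h.1), if_neg fun h => x.1.2 (mul_eq_left.1 h.1),
      if_neg fun h => x.2.2 (mul_eq_left.1 h.2), if_neg hxk']
    norm_num

end ConjugationOfCommutators

/-! ### Eigenvalue ratios and the free point -/

section PointSpectrum

variable {H : Type u} [Group H]

theorem GroupCStar.of_mem_unitary (h : H) : GroupCStar.of h ∈ unitary (GroupCStar H) := by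
  have hone : GroupCStar.of (1 : H) = 1 := by
    rw [GroupCStar.of, ← PreGroupCStar.one_def, map_one]
  have hstar : star (GroupCStar.of h) = GroupCStar.of h⁻¹ := by
    rw [GroupCStar.of, GroupCStar.star_ofPre, PreGroupCStar.star_single, star_one, GroupCStar.of]
  rw [Unitary.mem_iff, hstar, ← GroupCStar.of_mul, ← GroupCStar.of_mul, inv_mul_cancel,
    mul_inv_cancel]
  exact ⟨hone, hone⟩

/-- The eigenvalues of `π(i_H(h))`. -/
def FaithfulIrrep.eigenvalues (π : FaithfulIrrep (GroupCStar H)) (h : H) : Set ℂ :=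
  {c | ∃ ξ : π.space, ξ ≠ 0 ∧ π.toHom (GroupCStar.of h) ξ = c • ξ}

theorem FaithfulIrrep.countable_eigenvalues (π : FaithfulIrrep (GroupCStar H))
    [TopologicalSpace.SeparableSpace π.space] (h : H) : (π.eigenvalues h).Countable :=
  _root_.countable_eigenvalues
    ⟨π.toHom (GroupCStar.of h), Unitary.map_mem π.toHom (GroupCStar.of_mem_unitary h)⟩

theorem FaithfulIrrep.ne_zero_of_mem_eigenvalues {π : FaithfulIrrep (GroupCStar H)} {h : H} {c : ℂ}
    (hc : c ∈ π.eigenvalues h) : c ≠ 0 := by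
  rintro rfl
  obtain ⟨ξ, hξ, h1⟩ := hc
  have h2 := ContinuousLinearMap.norm_map_of_mem_unitary
    (Unitary.map_mem π.toHom (GroupCStar.of_mem_unitary h)) ξ
  rw [h1, zero_smul, norm_zero, eq_comm, norm_eq_zero] at h2
  exact hξ h2

theorem IsDiagonalizableOp.exists_eigenvector {V : Type u} [NormedAddCommGroup V]
    [InnerProductSpace ℂ V] [Nontrivial V] {T : V →L[ℂ] V} (hT : IsDiagonalizableOp T) :
    ∃ (c : ℂ) (ξ : V), ξ ≠ 0 ∧ T ξ = c • ξ := by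
  obtain ⟨ι, b, μ, hμ⟩ := hT
  obtain ⟨i⟩ : Nonempty ι := by
    by_contra hempty
    rw [not_nonempty_iff] at hempty
    obtain ⟨v, hv⟩ := exists_ne (0 : V)
    refine hv (b.repr.injective ?_)
    ext i
    exact hempty.elim i
  exact ⟨μ i, b i, b.orthonormal.ne_zero i, hμ i⟩

/-- If `π ∘ γ_χ` is unitarily equivalent to its composition with the automorphism induced by an
automorphism `e` of `H`, then `χ(e(h)) / χ(h)` is a ratio of eigenvalues for each `h` such that
`π(i_H(h))` has an eigenvalue. -/
theorem FaithfulIrrep.exists_eigenvalue_ratio {π : FaithfulIrrep (GroupCStar H)} {χ : H →* Circle}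
    {e : MulAut H}
    (heq : ((π.comp (GroupCStar.twist χ)).comp (GroupCStar.congr e)).Equivalent
      (π.comp (GroupCStar.twist χ))) {h : H} {μ : ℂ} (hμ : μ ∈ π.eigenvalues h) :
    ∃ ν ∈ π.eigenvalues (e h), (χ (e h * h⁻¹) : ℂ) = μ / ν := by
  obtain ⟨U, hU⟩ := heq
  have hμ0 := ne_zero_of_mem_eigenvalues hμ
  obtain ⟨ξ, hξ, h1⟩ := hμ
  have hne (g : H) : (χ g : ℂ) ≠ 0 := Circle.coe_ne_zero _
  have hU' (η : π.space) : U ((χ (e h) : ℂ) • π.toHom (GroupCStar.of (e h)) η) =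
      (χ h : ℂ) • π.toHom (GroupCStar.of h) (U η) := by
    have h2 := hU (GroupCStar.of h) η
    have h3 : ((π.comp (GroupCStar.twist χ)).comp (GroupCStar.congr e)).toHom (GroupCStar.of h) =
        (χ (e h) : ℂ) • π.toHom (GroupCStar.of (e h)) := by
      change π.toHom (GroupCStar.twist χ (GroupCStar.congr e (GroupCStar.of h))) = _
      rw [GroupCStar.congr_of, GroupCStar.twist_of, map_smul]
    have h4 : (π.comp (GroupCStar.twist χ)).toHom (GroupCStar.of h) =
        (χ h : ℂ) • π.toHom (GroupCStar.of h) := by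
      change π.toHom (GroupCStar.twist χ (GroupCStar.of h)) = _
      rw [GroupCStar.twist_of, map_smul]
    rw [h3, h4] at h2
    exact h2
  -- Composition with automorphisms leaves the Hilbert space unchanged, so `U` acts on `π.space`.
  let U' : π.space ≃ₗᵢ[ℂ] π.space := U
  let η : π.space := U'.symm ξ
  have hη : U' η = ξ := U'.apply_symm_apply ξ
  -- `U` carries `χ(e h) π(e h)` to `χ(h) π(h)`, so the preimage `η` of the eigenvector has
  -- eigenvalue `χ(h) μ` for the former.
  refine ⟨(χ h : ℂ) * μ / χ (e h), ⟨η, fun h0 => hξ ?_, ?_⟩, ?_⟩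
  · rw [← hη, h0, map_zero]
  · have h2 : U' ((χ (e h) : ℂ) • π.toHom (GroupCStar.of (e h)) η) =
        U' (((χ h : ℂ) * μ) • η) := by
      refine (hU' η).trans ?_
      change (χ h : ℂ) • π.toHom (GroupCStar.of h) (U' η) = _
      rw [map_smul, hη, h1, smul_smul]
    have h3 := U'.injective h2
    rw [div_eq_inv_mul, mul_smul, ← h3, smul_smul, inv_mul_cancel₀ (hne _), one_smul]
  · rw [map_mul, map_inv, Circle.coe_mul, Circle.coe_inv]
    have h2 := hne h
    have h3 := hne (e h)
    field_simp

end PointSpectrum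

theorem proposition1 {G₁ : Type u} {G₂ : Type v} [Group G₁] [Group G₂]
    [Countable G₁] [Countable G₂] [Nontrivial G₁] [Nontrivial G₂]
    (hcard : 2 < ENat.card G₁ ∨ 2 < ENat.card G₂) :
    (∃ B : FreeGroupBasis ({a : G₁ // a ≠ 1} × {b : G₂ // b ≠ 1}) (cartesianSubgroup G₁ G₂),
      ∀ x, B x = commGen x) ∧
    ∃ (π : FaithfulIrrep (GroupCStar (cartesianSubgroup G₁ G₂)))
      (lam : commGens G₁ G₂ → Circle)
      (γ : GroupCStar (cartesianSubgroup G₁ G₂) ≃⋆ₐ[ℂ] GroupCStar (cartesianSubgroup G₁ G₂)),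
      IsChoiRep (commGens G₁ G₂) π ∧
      (∀ x : commGens G₁ G₂,
        γ (GroupCStar.of x.1) = (lam x : ℂ) • GroupCStar.of x.1) ∧
      IsFreePoint (Monoid.Coprod.toProd : Monoid.Coprod G₁ G₂ →* G₁ × G₂)
        (FaithfulSpectrum.mk (π.comp γ)) := by
  refine ⟨⟨cartesianSubgroupBasis G₁ G₂, cartesianSubgroupBasis_apply⟩, ?_⟩
  obtain ⟨a₀, ha₀⟩ := exists_ne (1 : G₁)
  obtain ⟨b₀, hb₀⟩ := exists_ne (1 : G₂)
  let x₀ : {a : G₁ // a ≠ 1} × {b : G₂ // b ≠ 1} := (⟨a₀, ha₀⟩, ⟨b₀, hb₀⟩)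
  obtain ⟨x₁, hne, -⟩ := exists_commutator_ne hcard x₀ ha₀ hb₀
  let B := cartesianSubgroupBasis G₁ G₂
  have := B.countable
  obtain ⟨π, hsep, hdiag⟩ := exists_choi_representation B hne
  simp only [B, cartesianSubgroupBasis_apply] at hdiag
  -- The exceptional set depends on `π` alone, so a single `χ` can be chosen for all sections `n`
  -- and all `k`.
  have hD : (⋃ (g : cartesianSubgroup G₁ G₂) (h : cartesianSubgroup G₁ G₂),
      Set.image2 (· / ·) (π.eigenvalues g) (π.eigenvalues h)).Countable :=
    Set.countable_iUnion fun g => Set.countable_iUnion fun h =>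
      (π.countable_eigenvalues g).image2 (π.countable_eigenvalues h) _
  obtain ⟨χ, hχ⟩ := exists_generic_character B hD
  refine ⟨π, fun x => χ x.1, GroupCStar.twist χ, ⟨commGen x₀, ⟨x₀, rfl⟩, ?_⟩,
    fun x => GroupCStar.twist_of χ x.1, fun n hn k hk heq => ?_⟩
  · rintro _ ⟨x, rfl⟩ hx
    exact hdiag x fun h => hx (congrArg commGen h)
  · obtain ⟨x, hx, y, hxy⟩ := exists_exponentSum_conjNormal_ne hcard x₀ (inv_ne_one.2 hk)
      (hn.1 k⁻¹)
    have := π.nontrivial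
    obtain ⟨μ, hμ⟩ := (hdiag x hx).exists_eigenvector
    have hμ' : μ ∈ π.eigenvalues (commGen x) := hμ
    obtain ⟨ν, hν, hratio⟩ := FaithfulIrrep.exists_eigenvalue_ratio (Quotient.exact heq) hμ'
    -- The quotient of the conjugate of `[a, b]` by `[a, b]` has a nonzero exponent sum at `y`, yet
    -- `χ` takes an eigenvalue ratio there.
    refine hχ _ y (fun h => hxy ?_) (Set.mem_iUnion₂.2 ⟨_, _, _, hμ', _, hν, hratio.symm⟩)
    rwa [map_mul, map_inv, mul_inv_eq_one] at h
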